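/- **Invertible circuit sequences.** A randomized circuit $\{0,1\}^k\times\{0,1\}^{r}\to\{0,1\}^k$ is a Boolean circuit over NOT, AND, OR. An invertible circuit sequence on $k$ bits is a finite sequence of pairs $(C_{i,\rightarrow},C_{i,\leftarrow})_{i\in[\ell]}$ of randomized circuits $\{0,1\}^k\times\{0,1\}^{r_i}\to\{0,1\}^k$ with $C_{i,\leftarrow}(C_{i,\rightarrow}(x;z);z)=x$ for all $x\in\{0,1\}^k$, $z\in\{0,1\}^{r_i}$; it is $r$-invertible if $r_i\le r$ for all $i$. Its output distribution state is the normalization of $$|C(R)\rangle:=\sum_{z_1\in\{0,1\}^{r_1},\dots,z_\ell\in\{0,1\}^{r_\ell}}\bigl|C_{\ell,\rightarrow}(\cdots C_{2,\rightarrow}(C_{1,\rightarrow}(0^k;z_1);z_2)\cdots;z_\ell)\bigr\rangle .$$ **The uniform order interference (OI) oracle.** For unitaries $U_1,\dots,U_m$ on a register $R$ let $\mathbf{OI}(\{U_i\},|\psi\rangle)=\sum_{\sigma\in S_m}U_{\sigma^{-1}(m)}\cdots U_{\sigma^{-1}(1)}|\psi\rangle$. A call consists of $m\ge1$ unitary circuits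 $U_i$ over the gates $X,Z,P,H,T,\mathrm{CNOT},\mathrm{SWAP},\mathrm{Tof}$ acting on a common register $R$, and of an integer $\lambda\ge1$; it takes time $\sum_i|U_i|+\lambda$. Write the joint state of $R$ and the remaining qubits $R'$ as $\sum_y\alpha_y|\psi_y\rangle_R|y\rangle_{R'}$ with unit vectors $\psi_y$, and $U_{\sigma^{-1}(m)}\cdots U_{\sigma^{-1}(1)}|\psi_y\rangle=\sum_x\alpha_{y,x,\sigma}|x\rangle$. The call succeeds with probability $$\min_{y:\alpha_y\ne0}\ \frac{\sum_x\bigl|\sum_\sigma\alpha_{y,x,\sigma}\bigr|}{\sum_x\sum_\sigma|\alpha_{y,x,\sigma}|}\cdot\frac{\|\mathbf{OI}(\{U_i\},\psi_y)\|/m!}{\|\mathbf{OI}(\{U_i\},\psi_y)\|/m!+1/\lambda}$$ and reports whether it succeeded. After a success the joint state is the normalization of $\sum_y\alpha_y\,\mathbf{OI}(\{U_i\},|\psi_y\rangle)_R|y\rangle_{R'}$; after a failure it may be arbitrary. **Theorem.** There are a quantum algorithm $Q$ with access to a uniform OI oracle (a single random access machine program with classical memory, qubits that are initially $|0\rangle$,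 the above gates, measurements and oracle calls) and a polynomial $\mathsf{poly}$ such that the following holds for every integer $\delta\ge1$, every $r\ge 0$, every $r$-invertible circuit sequence $C$ on $k$ bits, of total description size $n$, and however the oracle behaves after failures. On input $(\delta,C)$, in every run, $Q$ halts within time $O(\delta\cdot\mathsf{poly}(n)\cdot2^{r})$ and outputs a bit $b\in\{0,1\}$ together with a register of $k$ qubits. The probability that $b=1$ is at least $1-\frac1\delta$, and whenever $b=1$ the register is in the pure state $|C(R)\rangle/\||C(R)\rangle\|$. -/

import Mathlib

namespace OIModel

noncomputable section

/-! ### Classical randomized circuits over NOT, AND, OR -/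

/-- A classical gate; its arguments are the positions of earlier wires. -/
inductive BGate where
  | not (i : ℕ)
  | and (i j : ℕ)
  | or (i j : ℕ)

/-- All argument wires of the gate are among the first `w` wires. -/
def BGate.InRange (w : ℕ) : BGate → Prop
  | .not i => i < w
  | .and i j => i < w ∧ j < w
  | .or i j => i < w ∧ j < w

/-- The value of a gate, given the list of values of the earlier wires. -/
def BGate.eval (w : List Bool) : BGate → Bool
  | .not i => !(w.getD i false)
  | .and i j => w.getD i false && w.getD j false
  | .or i j => w.getD i false || w.getD j false

/-- A randomized circuit `{0,1}^k × {0,1}^r → {0,1}^k` in straight-line form. The wires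
`0, …, k-1` carry the input, the wires `k, …, k+r-1` carry the random bits, and each gate
creates the next wire; `out` selects the output wires. -/
structure RandCircuit (k r : ℕ) where
  gates : List BGate
  out : Fin k → ℕ
  gates_wf : ∀ (t : ℕ) (h : t < gates.length), (gates[t]).InRange (k + r + t)
  out_wf : ∀ i, out i < k + r + gates.length

/-- The values of all wires, on input `x` and randomness `z`. -/
def RandCircuit.wires {k r : ℕ} (C : RandCircuit k r) (x : Fin k → Bool) (z : Fin r → Bool) :
    List Bool :=
  C.gates.foldl (fun w g => w ++ [g.eval w]) (List.ofFn x ++ List.ofFn z)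

/-- `C(x; z)`. -/
def RandCircuit.eval {k r : ℕ} (C : RandCircuit k r) (x : Fin k → Bool) (z : Fin r → Bool) :
    Fin k → Bool :=
  fun i => (C.wires x z).getD (C.out i) false

/-! ### Invertible circuit sequences -/

/-- One pair `(C_→, C_←)` on `k` bits with `r` random bits: for each fixed randomness the
backward circuit inverts the forward circuit. -/
structure InvPair (k : ℕ) where
  r : ℕ
  fwd : RandCircuit k r
  bwd : RandCircuit k r
  inv : ∀ (z : Fin r → Bool) (x : Fin k → Bool), bwd.eval (fwd.eval x z) z = x

/-- An invertible circuit sequence of length `ℓ` on `k` bits. -/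
structure InvCircuitSeq where
  k : ℕ
  ℓ : ℕ
  pair : Fin ℓ → InvPair k

/-- The sequence is `r`-invertible: every pair uses at most `r` random bits. -/
def InvCircuitSeq.IsInvertible (C : InvCircuitSeq) (r : ℕ) : Prop :=
  ∀ i, (C.pair i).r ≤ r

/-- `C_ℓ(⋯ C_2(C_1(0^k; z_1); z_2) ⋯ ; z_ℓ)`, with all circuits in the forward direction. -/
def InvCircuitSeq.sample (C : InvCircuitSeq) (z : (i : Fin C.ℓ) → Fin (C.pair i).r → Bool) :
    Fin C.k → Bool :=
  Fin.foldl C.ℓ (fun x i => (C.pair i).fwd.eval x (z i)) (fun _ => false)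

/-- The unnormalized output distribution state `|C(R)⟩ = ∑_z |C_ℓ(⋯ C_1(0^k; z_1) ⋯ ; z_ℓ)⟩`. -/
def InvCircuitSeq.outVec (C : InvCircuitSeq) : EuclideanSpace ℂ (Fin C.k → Bool) :=
  ∑ z : (i : Fin C.ℓ) → Fin (C.pair i).r → Bool, EuclideanSpace.single (C.sample z) (1 : ℂ)

/-- The normalized output distribution state. -/
def InvCircuitSeq.outState (C : InvCircuitSeq) : EuclideanSpace ℂ (Fin C.k → Bool) :=
  ((‖C.outVec‖⁻¹ : ℝ) : ℂ) • C.outVec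

/-! The description of a sequence is a list of natural numbers. -/

def BGate.encode : BGate → List ℕ
  | .not i => [0, i, 0]
  | .and i j => [1, i, j]
  | .or i j => [2, i, j]

def RandCircuit.encode {k r : ℕ} (C : RandCircuit k r) : List ℕ :=
  C.gates.length :: (C.gates.flatMap BGate.encode ++ List.ofFn C.out)

def InvPair.encode {k : ℕ} (p : InvPair k) : List ℕ :=
  p.r :: (p.fwd.encode ++ p.bwd.encode)

def InvCircuitSeq.encode (C : InvCircuitSeq) : List ℕ :=
  C.k :: C.ℓ :: (List.ofFn fun i => (C.pair i).encode).flatten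

/-- The total description size: the number of bits of the description, each number being written
in binary and followed by one separator. -/
def InvCircuitSeq.descSize (C : InvCircuitSeq) : ℕ :=
  (C.encode.map fun a => a.size + 1).sum

/-! ### Quantum states and gates

The memory has qubits `0, 1, 2, …`, all but finitely many of which are `|0⟩`. A basis state is
given by the finite set of the qubits that are `1`; a vector is a finite combination of basis
states. -/

/-- A basis state: the set of qubits with value `1`. -/
abbrev Ket : Type := Finset ℕ

/-- A (not necessarily normalized) vector of amplitudes. -/
abbrev QVec : Type := Ket →₀ ℂ

namespace QVec

/-- `∑ |amplitude|²`. -/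
def normSq (ψ : QVec) : ℝ := ψ.sum fun _ a => ‖a‖ ^ 2

/-- The Euclidean norm. -/
def norm (ψ : QVec) : ℝ := Real.sqrt (normSq ψ)

def normalize (ψ : QVec) : QVec := (((norm ψ)⁻¹ : ℝ) : ℂ) • ψ

end QVec

/-- Quantum gates, with the labels `a, b, c` of the qubits they act on. `P` is the phase gate
`diag(1, i)` and `T` is `diag(1, e^{iπ/4})`. In `CNOT` and `Tof` the last label is the target. -/
inductive Gate where
  | X (a : ℕ)
  | Z (a : ℕ)
  | P (a : ℕ)
  | H (a : ℕ)
  | T (a : ℕ)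
  | CNOT (a b : ℕ)
  | SWAP (a b : ℕ)
  | Tof (a b c : ℕ)

namespace Gate

/-- Replace every label `a` by `f a`. -/
def map (f : ℕ → ℕ) : Gate → Gate
  | X a => X (f a)
  | Z a => Z (f a)
  | P a => P (f a)
  | H a => H (f a)
  | T a => T (f a)
  | CNOT a b => CNOT (f a) (f b)
  | SWAP a b => SWAP (f a) (f b)
  | Tof a b c => Tof (f a) (f b) (f c)

/-- The labels are pairwise distinct. -/
def Valid : Gate → Prop
  | CNOT a b => a ≠ b
  | SWAP a b => a ≠ b
  | Tof a b c => a ≠ b ∧ a ≠ c ∧ b ≠ c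
  | _ => True

/-- The set of qubits the gate acts on. -/
def qubits : Gate → Finset ℕ
  | X a => {a}
  | Z a => {a}
  | P a => {a}
  | H a => {a}
  | T a => {a}
  | CNOT a b => {a, b}
  | SWAP a b => {a, b}
  | Tof a b c => {a, b, c}

/-- Flip qubit `a` of a basis state. -/
def flip (a : ℕ) (s : Ket) : Ket := if a ∈ s then s.erase a else insert a s

/-- The image of a basis state under a gate. -/
def onKet : Gate → Ket → QVec
  | X a, s => Finsupp.single (flip a s) 1
  | Z a, s => Finsupp.single s (if a ∈ s then -1 else 1)
  | P a, s => Finsupp.single s (if a ∈ s then Complex.I else 1)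
  | H a, s =>
      Finsupp.single (s.erase a) (((Real.sqrt 2)⁻¹ : ℝ) : ℂ) +
        Finsupp.single (insert a s)
          ((if a ∈ s then -1 else 1) * (((Real.sqrt 2)⁻¹ : ℝ) : ℂ))
  | T a, s => Finsupp.single s (if a ∈ s then Complex.exp (Real.pi / 4 * Complex.I) else 1)
  | CNOT a b, s => Finsupp.single (if a ∈ s then flip b s else s) 1
  | SWAP a b, s => Finsupp.single (s.image (Equiv.swap a b)) 1
  | Tof a b c, s => Finsupp.single (if a ∈ s ∧ b ∈ s then flip c s else s) 1

open Classical in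
/-- The action of a gate on vectors, by linearity. A gate with a repeated label does nothing. -/
def apply (g : Gate) (ψ : QVec) : QVec :=
  if g.Valid then Finsupp.linearCombination ℂ g.onKet ψ else ψ

end Gate

/-- A unitary circuit: a list of gates, the first one being applied first. It uses neither
measurements nor fresh ancillas. Its size `|U|` is its length. -/
abbrev QCircuit : Type := List Gate

def QCircuit.apply (U : QCircuit) (ψ : QVec) : QVec := U.foldl (fun φ g => g.apply φ) ψ

/-! ### The uniform order interference oracle -/

/-- The classical part of a call: the family `U_1, …, U_m`, the register `R` (a set of qubits) and
the amplification parameter `λ`. -/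
structure OIQuery where
  circuits : List QCircuit
  reg : Finset ℕ
  lam : ℕ

namespace OIQuery

/-- There is at least one circuit, `R` is nonempty, `λ` is positive, and all circuits are
circuits on `R`. -/
def Valid (q : OIQuery) : Prop :=
  0 < q.circuits.length ∧ q.reg.Nonempty ∧ 0 < q.lam ∧
    ∀ U ∈ q.circuits, ∀ g ∈ U, g.Valid ∧ g.qubits ⊆ q.reg

/-- The time of a call, `∑ |U_i| + λ`. -/
def cost (q : OIQuery) : ℕ := (q.circuits.map List.length).sum + q.lam

/-- `U_{σ⁻¹(m)} ⋯ U_{σ⁻¹(2)} U_{σ⁻¹(1)} ψ`. -/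
def ordered (q : OIQuery) (σ : Equiv.Perm (Fin q.circuits.length)) (ψ : QVec) : QVec :=
  Fin.foldl q.circuits.length (fun φ i => (q.circuits.get (σ⁻¹ i)).apply φ) ψ

/-- The uniform order interference vector `∑_σ U_{σ⁻¹(m)} ⋯ U_{σ⁻¹(1)} ψ`. -/
def OI (q : OIQuery) (ψ : QVec) : QVec :=
  ∑ σ : Equiv.Perm (Fin q.circuits.length), q.ordered σ ψ

/-- The values `y` of the qubits outside `R` that occur in `ψ` (those with `α_y ≠ 0`). -/
def branches (q : OIQuery) (ψ : QVec) : Finset Ket := ψ.support.image fun s => s \ q.reg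

/-- The normalized vector `|ψ_y⟩_R |y⟩_{R'}`, where `ψ = ∑_y α_y |ψ_y⟩_R |y⟩_{R'}` and `R'` is the
register of all qubits outside `R`. -/
def branch (q : OIQuery) (ψ : QVec) (y : Ket) : QVec :=
  QVec.normalize (Finsupp.filter (fun s : Ket => s \ q.reg = y) ψ)

/-- The phase alignment `∑_x |∑_σ α_{y,x,σ}| / ∑_x ∑_σ |α_{y,x,σ}|` of the branch `y`, where `x`
ranges over the basis states of `R`. -/
def alignment (q : OIQuery) (ψ : QVec) (y : Ket) : ℝ :=
  (∑ x ∈ q.reg.powerset,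
      ‖∑ σ : Equiv.Perm (Fin q.circuits.length), q.ordered σ (q.branch ψ y) (x ∪ y)‖) /
    ∑ x ∈ q.reg.powerset,
      ∑ σ : Equiv.Perm (Fin q.circuits.length), ‖q.ordered σ (q.branch ψ y) (x ∪ y)‖

/-- `‖OI({U_i}, ψ_y)‖ / m!`. -/
def scaledNorm (q : OIQuery) (ψ : QVec) (y : Ket) : ℝ :=
  QVec.norm (q.OI (q.branch ψ y)) / (q.circuits.length.factorial : ℝ)

open Classical in
/-- The success probability of a call on the joint state `ψ`: the minimum over `y`, which ranges
over a finite set (nonempty if `ψ ≠ 0`). An invalid call always fails. -/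
def successProb (q : OIQuery) (ψ : QVec) : ℝ :=
  if q.Valid then
    ⨅ y : q.branches ψ,
      q.alignment ψ y * (q.scaledNorm ψ y / (q.scaledNorm ψ y + 1 / (q.lam : ℝ)))
  else 0

lemma alignment_mem (q : OIQuery) (ψ : QVec) (y : Ket) : q.alignment ψ y ∈ unitInterval := by
  unfold alignment
  refine ⟨by positivity, div_le_one_of_le₀ ?_ (by positivity)⟩
  exact Finset.sum_le_sum fun x _ => norm_sum_le _ _

lemma successProb_mem (q : OIQuery) (ψ : QVec) : q.successProb ψ ∈ unitInterval := by
  unfold successProb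
  have hs : ∀ y, 0 ≤ q.scaledNorm ψ y := fun y =>
    div_nonneg (Real.sqrt_nonneg _) (Nat.cast_nonneg _)
  have h : ∀ y, q.alignment ψ y *
      (q.scaledNorm ψ y / (q.scaledNorm ψ y + 1 / (q.lam : ℝ))) ∈ unitInterval := fun y => by
    have hl : (0 : ℝ) ≤ 1 / (q.lam : ℝ) := by positivity
    exact unitInterval.mul_mem (q.alignment_mem ψ y)
      ⟨div_nonneg (hs y) (add_nonneg (hs y) hl),
        div_le_one_of_le₀ (by linarith) (add_nonneg (hs y) hl)⟩
  split_ifs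
  · refine ⟨Real.iInf_nonneg fun y => (h y).1, ?_⟩
    rcases isEmpty_or_nonempty (q.branches ψ) with he | ⟨⟨y⟩⟩
    · rw [Real.iInf_of_isEmpty]; exact zero_le_one
    · exact (ciInf_le ⟨0, by rintro _ ⟨z, rfl⟩; exact (h z).1⟩ y).trans (h y).2
  · exact ⟨le_rfl, zero_le_one⟩

end OIQuery

/-- A uniform order interference oracle. Its behaviour is fixed up to the state that is left after
a failed call. That state may be arbitrary: any unit vector, or any random choice of unit vectors,
which may depend on the time of the call, the query and the joint state before the call. -/
structure OIOracle where
  onFail : ℕ → OIQuery → QVec → PMF QVec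
  onFail_unit : ∀ t q ψ, ∀ φ ∈ (onFail t q ψ).support, QVec.norm φ = 1

/-! ### Quantum algorithms with access to the oracle

A random access machine with a classical memory of natural numbers (initially `0`), a read-only
input, the quantum memory (initially all `|0⟩`), and a write-only query tape for the oracle. -/

/-- Instructions. The arguments `d, a, b, …` are addresses of memory cells; the labels of a gate are
addresses of the cells that hold the numbers of the qubits. -/
inductive Instr where
  /-- `mem[d] := n` -/
  | const (d n : ℕ)
  /-- `mem[d] := mem[a] + mem[b]` -/
  | add (d a b : ℕ)
  /-- `mem[d] := mem[a] - mem[b]`, truncated at `0` -/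
  | sub (d a b : ℕ)
  /-- `mem[d] := mem[mem[a]]` -/
  | load (d a : ℕ)
  /-- `mem[mem[d]] := mem[a]` -/
  | store (d a : ℕ)
  /-- `mem[d] := input[mem[a]]`, which is `0` beyond the end of the input -/
  | read (d a : ℕ)
  /-- if `mem[a] = 0`, continue at position `t` of the program -/
  | jz (a t : ℕ)
  /-- apply a quantum gate -/
  | gate (g : Gate)
  /-- measure qubit number `mem[a]` in the standard basis; `mem[d] :=` the outcome -/
  | measure (d a : ℕ)
  /-- start a new empty circuit on the query tape -/
  | newCircuit
  /-- append a gate to the current circuit on the query tape -/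
  | queryGate (g : Gate)
  /-- put qubit number `mem[a]` into the register `R` on the query tape -/
  | queryQubit (a : ℕ)
  /-- call the oracle with `λ = mem[a]`; `mem[d] :=` the success bit; clear the query tape -/
  | call (d a : ℕ)

/-- A program; the machine halts when the position leaves the program. -/
abbrev Program : Type := List Instr

structure Config where
  /-- position in the program -/
  pc : ℕ
  /-- the time spent so far -/
  time : ℕ
  mem : ℕ → ℕ
  /-- the circuits on the query tape, the current one first -/
  circuits : List QCircuit
  /-- the register on the query tape -/
  reg : Finset ℕ
  state : QVec

/-- Append a gate to the current circuit, if there is one. -/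
def appendGate (g : Gate) : List QCircuit → List QCircuit
  | [] => []
  | U :: L => (U ++ [g]) :: L

/-- `true` with probability `p`. -/
def coin (p : unitInterval) : PMF Bool :=
  PMF.ofFintype (fun b => if b then ENNReal.ofReal p else ENNReal.ofReal (1 - p)) (by
    have h1 : (0 : ℝ) ≤ 1 - (p : ℝ) := sub_nonneg.2 p.2.2
    simp [← ENNReal.ofReal_add p.2.1 h1])

/-- The part of `ψ` in which qubit `a` has the value `b`. -/
def project (a : ℕ) (b : Bool) (ψ : QVec) : QVec := Finsupp.filter (fun s : Ket => decide (a ∈ s) = b) ψ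

/-- The probability that measuring qubit `a` gives `1` (for a unit vector the denominator is `1`). -/
def measureProb (a : ℕ) (ψ : QVec) : ℝ :=
  QVec.normSq (project a true ψ) / QVec.normSq ψ

lemma measureProb_mem (a : ℕ) (ψ : QVec) : measureProb a ψ ∈ unitInterval := by
  have h0 : ∀ φ : QVec, 0 ≤ QVec.normSq φ := fun φ => Finset.sum_nonneg fun s _ => sq_nonneg _
  refine ⟨div_nonneg (h0 _) (h0 _), div_le_one_of_le₀ ?_ (h0 _)⟩
  unfold QVec.normSq project Finsupp.sum
  rw [Finsupp.support_filter]
  refine (Finset.sum_le_sum_of_subset_of_nonneg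
    (Finset.filter_subset (fun s : Ket => decide (a ∈ s) = true) ψ.support)
    fun s _ _ => sq_nonneg _).trans' (le_of_eq ?_)
  refine Finset.sum_congr rfl fun s hs => ?_
  rw [Finsupp.filter_apply_pos (fun s : Ket => decide (a ∈ s) = true) _ (Finset.mem_filter.1 hs).2]

/-- The query that a call with `λ = mem[a]` makes. -/
def Config.query (c : Config) (a : ℕ) : OIQuery := ⟨c.circuits, c.reg, c.mem a⟩

/-- The effect of one instruction. Every instruction takes time `1`; a call to the oracle takes
time `∑ |U_i| + λ` in addition. -/
def execInstr (O : OIOracle) (input : List ℕ) (c : Config) : Instr → PMF Config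
  | .const d n => PMF.pure
      { c with pc := c.pc + 1, time := c.time + 1, mem := Function.update c.mem d n }
  | .add d a b => PMF.pure
      { c with pc := c.pc + 1, time := c.time + 1,
               mem := Function.update c.mem d (c.mem a + c.mem b) }
  | .sub d a b => PMF.pure
      { c with pc := c.pc + 1, time := c.time + 1,
               mem := Function.update c.mem d (c.mem a - c.mem b) }
  | .load d a => PMF.pure
      { c with pc := c.pc + 1, time := c.time + 1,
               mem := Function.update c.mem d (c.mem (c.mem a)) }
  | .store d a => PMF.pure
      { c with pc := c.pc + 1, time := c.time + 1,
               mem := Function.update c.mem (c.mem d) (c.mem a) }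
  | .read d a => PMF.pure
      { c with pc := c.pc + 1, time := c.time + 1,
               mem := Function.update c.mem d (input.getD (c.mem a) 0) }
  | .jz a t => PMF.pure
      { c with pc := if c.mem a = 0 then t else c.pc + 1, time := c.time + 1 }
  | .gate g => PMF.pure
      { c with pc := c.pc + 1, time := c.time + 1, state := (g.map c.mem).apply c.state }
  | .measure d a =>
      (coin ⟨measureProb (c.mem a) c.state, measureProb_mem _ _⟩).map fun b =>
        { c with pc := c.pc + 1, time := c.time + 1,
                 mem := Function.update c.mem d b.toNat,
                 state := QVec.normalize (project (c.mem a) b c.state) }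
  | .newCircuit => PMF.pure
      { c with pc := c.pc + 1, time := c.time + 1, circuits := [] :: c.circuits }
  | .queryGate g => PMF.pure
      { c with pc := c.pc + 1, time := c.time + 1,
               circuits := appendGate (g.map c.mem) c.circuits }
  | .queryQubit a => PMF.pure
      { c with pc := c.pc + 1, time := c.time + 1, reg := insert (c.mem a) c.reg }
  | .call d a =>
      (coin ⟨(c.query a).successProb c.state, (c.query a).successProb_mem _⟩).bind fun b =>
        (if b then PMF.pure (QVec.normalize ((c.query a).OI c.state))
          else O.onFail c.time (c.query a) c.state).map fun φ =>
            { pc := c.pc + 1, time := c.time + 1 + (c.query a).cost,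
              mem := Function.update c.mem d b.toNat,
              circuits := [], reg := ∅, state := φ }

def Program.Halted (Q : Program) (c : Config) : Prop := Q.length ≤ c.pc

/-- One step; a halted machine stays as it is and spends no time. -/
def Program.step (Q : Program) (O : OIOracle) (input : List ℕ) (c : Config) : PMF Config :=
  match Q[c.pc]? with
  | none => PMF.pure c
  | some i => execInstr O input c i

def initConfig : Config where
  pc := 0
  time := 0
  mem := fun _ => 0
  circuits := []
  reg := ∅
  state := Finsupp.single ∅ 1

/-- The distribution of the configuration after `N` steps. -/
def Program.run (Q : Program) (O : OIOracle) (input : List ℕ) : ℕ → PMF Config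
  | 0 => PMF.pure initConfig
  | N + 1 => (Q.run O input N).bind (Q.step O input)

/-- On the given input `Q` always halts, after total time at most `T`, whatever the outcomes of
measurements and oracle calls are. (Each step takes time at least `1`, so that `T` steps
suffice.) -/
def Program.HaltsWithin (Q : Program) (O : OIOracle) (input : List ℕ) (T : ℕ) : Prop :=
  ∀ c ∈ (Q.run O input T).support, Q.Halted c ∧ c.time ≤ T

/-- The output bit is in cell `0`. -/
def Config.outBit (c : Config) : ℕ := c.mem 0

/-- The output register, consisting of the qubits `0, …, k-1`, is in the pure state `φ`: the joint
state is `φ ⊗ χ` for a unit vector `χ` on the other qubits. -/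
def Config.OutputIs {k : ℕ} (c : Config) (φ : EuclideanSpace ℂ (Fin k → Bool)) : Prop :=
  ∃ χ : QVec, QVec.norm χ = 1 ∧ (∀ s ∈ χ.support, Disjoint s (Finset.range k)) ∧
    ∀ s : Ket, c.state s = φ (fun i => decide ((i : ℕ) ∈ s)) * χ (s \ Finset.range k)

end

end OIModel

/-!
A pair of circuits maps the uniform superposition of a multiset of data `x` to the one of all
`C_→(x; z)`. To achieve this, the program puts `r` qubits `z` into the uniform superposition with
Hadamard gates, evaluates `C_→` reversibly next to `x`, and evaluates `C_←` to erase the old `x`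
(`InvPair.move_circuit`). It remains to get rid of `z` without a measurement, and this is done by
one oracle call for each qubit `q` of `z`, with the two circuits `X a` and `CNOT a q`, where `a` is
a qubit in the state `0`. The two orders map `q` to itself and to its negation, respectively, so
that the interference applies `1 + X` to `q` (`normalize_OI_eraseQuery`). Whatever `q` was before,
it is now in the uniform superposition, not entangled with anything else, and a Hadamard gate
resets it to `0`.

All amplitudes before the call are nonnegative and the circuits permute the basis states. Hence
nothing cancels: the phases are aligned and the interference vector has at least the length of one
summand (`OIQuery.le_successProb`), so that a call with parameter `λ` fails with probability at
most `2 / λ`. With `λ = 2 δ t (t + 1)` in the `t`-th call, the sum of the failure probabilities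
telescopes and is at most `1 / δ`. The program makes one call for each random bit; the number of
random bits of a pair is written in binary, and it is only here that a factor such as `2 ^ r` is
needed.

The program makes no measurements, so it has a single run in which all calls succeed, and every
other run ends with output bit `0` right after a failed call (`Program.Path.evolve`). The analysis
of the program is thus that of a deterministic machine; it is carried out for structured programs
(`Cmd`), by rules in the style of Hoare logic (`Runs`).
-/

namespace OIModel

noncomputable section

open scoped ComplexOrder

/-! ### Runs of a program in which every oracle call succeeds -/

/-- The list `L` occurs in `M` as the block of consecutive entries that begins at position `p`. -/
def SitsAt {α : Type*} (M : List α) (p : ℕ) (L : List α) : Prop := L <+: M.drop p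

namespace SitsAt

variable {α : Type*} {M A B L : List α} {p : ℕ} {x : α}

lemma left (h : SitsAt M p (A ++ B)) : SitsAt M p A := (List.prefix_append A B).trans h

lemma right (h : SitsAt M p (A ++ B)) : SitsAt M (p + A.length) B := by
  obtain ⟨t, ht⟩ := h
  refine ⟨t, ?_⟩
  rw [← List.drop_drop, ← ht, List.append_assoc, List.drop_left]

lemma tail (h : SitsAt M p (x :: L)) : SitsAt M (p + 1) L := right (A := [x]) h

lemma head (h : SitsAt M p (x :: L)) : M[p]? = some x := by
  obtain ⟨t, ht⟩ := h
  have h0 : (M.drop p)[0]? = M[p + 0]? := List.getElem?_drop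
  rw [← ht] at h0
  simpa using h0.symm

lemma getD_head (h : SitsAt M p (x :: L)) (y : α) : M.getD p y = x := by
  rw [List.getD_eq_getElem?_getD, h.head]; rfl

end SitsAt

/-- The distribution of the configuration `N` steps after `c`. -/
def Program.evolve (Q : Program) (O : OIOracle) (input : List ℕ) : ℕ → Config → PMF Config
  | 0, c => PMF.pure c
  | N + 1, c => (Q.step O input c).bind (Q.evolve O input N)

lemma Program.evolve_succ' (Q : Program) (O : OIOracle) (input : List ℕ) (N : ℕ) (c : Config) :
    Q.evolve O input (N + 1) c = (Q.evolve O input N c).bind (Q.step O input) := by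
  induction N generalizing c with
  | zero => simp [Program.evolve, PMF.pure_bind, PMF.bind_pure]
  | succ N ih =>
    have h (M : ℕ) (c : Config) : Q.evolve O input (M + 1) c =
      (Q.step O input c).bind (Q.evolve O input M) := rfl
    rw [h (N + 1), h N, PMF.bind_bind]
    exact congrArg _ (funext ih)

lemma Program.run_eq_evolve (Q : Program) (O : OIOracle) (input : List ℕ) (N : ℕ) :
    Q.run O input N = Q.evolve O input N initConfig := by
  induction N with
  | zero => rfl
  | succ N ih => rw [Program.evolve_succ', Program.run, ih]

lemma Program.evolve_halted (Q : Program) (O : OIOracle) (input : List ℕ) (N : ℕ) {c : Config}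
    (h : Q.Halted c) : Q.evolve O input N c = PMF.pure c := by
  induction N with
  | zero => rfl
  | succ N ih =>
    have : Q.step O input c = PMF.pure c := by
      unfold Program.step
      rw [List.getElem?_eq_none h]
    rw [Program.evolve, this, PMF.pure_bind, ih]

/-- The position to which a program jumps after a failed oracle call; it lies outside every program
of at most this length. -/
def exitPos : ℕ := 1000

/-- The configuration after a successful call with `λ = mem[a]` and success bit in cell `0`. -/
def Config.succCall (c : Config) (a : ℕ) : Config where
  pc := c.pc + 1
  time := c.time + 1 + (c.query a).cost
  mem := Function.update c.mem 0 1
  circuits := []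
  reg := ∅
  state := QVec.normalize ((c.query a).OI c.state)

/-- `Q.Path input c c' f`: from `c` the program reaches `c'` if all oracle calls on the way succeed,
and `f` bounds the sum of their failure probabilities. Each of these calls reports to cell `0` and
is followed by an exit from the program in the case of failure. -/
inductive Program.Path (Q : Program) (input : List ℕ) : Config → Config → ℝ → Prop
  | refl (c : Config) : Path Q input c c 0
  | step {c₁ c₂ c₃ : Config} {f : ℝ} (h : ∀ O, Q.step O input c₁ = PMF.pure c₂)
      (ht : c₁.time < c₂.time) (hp : Path Q input c₂ c₃ f) : Path Q input c₁ c₃ f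
  | call {c c' : Config} {a : ℕ} {e f : ℝ} (h : Q[c.pc]? = some (.call 0 a))
      (h' : Q[c.pc + 1]? = some (.jz 0 exitPos)) (he : 1 - (c.query a).successProb c.state ≤ e)
      (hp : Path Q input (c.succCall a) c' f) : Path Q input c c' (e + f)

namespace Program.Path

variable {Q : Program} {input : List ℕ} {c₁ c₂ c₃ c c' : Config} {f g : ℝ}

lemma trans (h : Q.Path input c₁ c₂ f) (h' : Q.Path input c₂ c₃ g) :
    Q.Path input c₁ c₃ (f + g) := by
  induction h with
  | refl c => simpa using h'
  | step h ht _ ih => exact .step h ht (ih h')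
  | call h h1 he _ ih => rw [add_assoc]; exact .call h h1 he (ih h')

lemma time_le (h : Q.Path input c c' f) : c.time ≤ c'.time := by
  induction h with
  | refl c => exact le_rfl
  | step h ht _ ih => omega
  | call h h1 he _ ih => simp only [Config.succCall] at ih; omega

lemma coin_true (p : unitInterval) : coin p true = ENNReal.ofReal p := by simp [coin]

/-- After a failed call the machine needs one more step to halt, and it halts with output bit `0`.
Hence a path to a halted configuration determines the outcome up to the failures. -/
lemma evolve (hQ : Q.length ≤ exitPos) (h : Q.Path input c c' f) (hh : Q.Halted c')
    (O : OIOracle) (N : ℕ) (hN : c'.time + 1 ≤ c.time + N) :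
    (∀ d ∈ (Q.evolve O input N c).support,
      d = c' ∨ Q.Halted d ∧ d.mem 0 = 0 ∧ d.time ≤ c'.time + 1) ∧
    1 - f ≤ (Q.evolve O input N c c').toReal := by
  induction h generalizing N with
  | refl c => simp [Q.evolve_halted O input N hh]
  | step h ht hp ih =>
    have := hp.time_le
    obtain ⟨M, rfl⟩ : ∃ M, N = M + 1 := ⟨N - 1, by omega⟩
    rw [Program.evolve, h O, PMF.pure_bind]
    exact ih hh M (by omega)
  | @call c c' a e f h h1 he hp ih =>
    have hle := hp.time_le
    simp only [Config.succCall] at hle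
    obtain ⟨M, rfl⟩ : ∃ M, N = M + 2 := ⟨N - 2, by omega⟩
    have hstep : Q.step O input c = execInstr O input c (.call 0 a) := by
      unfold Program.step; rw [h]
    obtain ⟨ih1, ih2⟩ := ih hh (M + 1) (by simp only [Config.succCall]; omega)
    rw [Program.evolve, hstep]
    constructor
    · intro d hd
      rw [execInstr, PMF.mem_support_bind_iff] at hd
      obtain ⟨d', hd', hd⟩ := hd
      rw [PMF.mem_support_bind_iff] at hd'
      obtain ⟨b, -, hd'⟩ := hd'
      rw [PMF.mem_support_map_iff] at hd'
      obtain ⟨φ, hφ, rfl⟩ := hd'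
      cases b with
      | true =>
        have : φ = QVec.normalize ((c.query a).OI c.state) := by simpa using hφ
        subst this
        exact ih1 d hd
      | false =>
        -- the next step is the exit from the program
        rw [Program.evolve] at hd
        have hs : ∀ c₀ : Config, c₀.pc = c.pc + 1 → c₀.mem 0 = 0 →
            Q.step O input c₀ = PMF.pure { c₀ with pc := exitPos, time := c₀.time + 1 } := by
          intro c₀ hpc hm
          unfold Program.step
          rw [hpc, h1]
          simp [execInstr, hm]
        rw [hs _ rfl (by simp), PMF.pure_bind,
          Program.evolve_halted _ _ _ _ (by exact hQ)] at hd
        rw [PMF.mem_support_pure_iff] at hd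
        subst hd
        exact Or.inr ⟨hQ, by simp, by simp only; omega⟩
    · set p := (c.query a).successProb c.state with hp
      have hpm := (c.query a).successProb_mem c.state
      set P := ((Q.evolve O input (M + 1) (c.succCall a)) c') with hP
      have hPt : P ≠ ⊤ := PMF.apply_ne_top _ _
      have hP1 : P.toReal ≤ 1 := by
        have := PMF.coe_le_one (Q.evolve O input (M + 1) (c.succCall a)) c'
        exact ENNReal.toReal_le_of_le_ofReal zero_le_one (by simpa using this)
      have key : ENNReal.ofReal p * P ≤
          ((execInstr O input c (.call 0 a)).bind (Q.evolve O input (M + 1))) c' := by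
        rw [execInstr, PMF.bind_bind, PMF.bind_apply]
        refine le_trans ?_ (ENNReal.le_tsum true)
        rw [coin_true]
        simp only [if_true, PMF.pure_map, PMF.pure_bind]
        exact le_rfl
      have hne : ((execInstr O input c (.call 0 a)).bind (Q.evolve O input (M + 1))) c' ≠ ⊤ :=
        PMF.apply_ne_top _ _
      have := ENNReal.toReal_mono hne key
      rw [ENNReal.toReal_mul, ENNReal.toReal_ofReal hpm.1] at this
      refine le_trans ?_ this
      nlinarith [mul_nonneg (sub_nonneg.2 hpm.2) (sub_nonneg.2 hP1)]

end Program.Path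

/-! ### Structured programs -/

/-- A configuration without the position in the program and the time. -/
structure St where
  mem : ℕ → ℕ
  circuits : List QCircuit
  reg : Finset ℕ
  state : QVec

/-- The configuration with data `S` at position `pc` and time `t`. -/
def St.config (S : St) (pc t : ℕ) : Config := ⟨pc, t, S.mem, S.circuits, S.reg, S.state⟩

/-- The instructions whose effect on `St` is a function and that are followed by the next
instruction, as far as they are used. -/
def Instr.Simple : Instr → Prop
  | .const _ _ | .add _ _ _ | .sub _ _ _ | .read _ _ | .gate _ | .newCircuit | .queryGate _
  | .queryQubit _ => True
  | _ => False

/-- The effect of a simple instruction. -/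
def Instr.effect (input : List ℕ) (S : St) : Instr → St
  | .const d n => { S with mem := Function.update S.mem d n }
  | .add d a b => { S with mem := Function.update S.mem d (S.mem a + S.mem b) }
  | .sub d a b => { S with mem := Function.update S.mem d (S.mem a - S.mem b) }
  | .read d a => { S with mem := Function.update S.mem d (input.getD (S.mem a) 0) }
  | .gate g => { S with state := (g.map S.mem).apply S.state }
  | .newCircuit => { S with circuits := [] :: S.circuits }
  | .queryGate g => { S with circuits := appendGate (g.map S.mem) S.circuits }
  | .queryQubit a => { S with reg := insert (S.mem a) S.reg }
  | _ => S

lemma Instr.Simple.execInstr {i : Instr} (h : i.Simple) (O : OIOracle) (input : List ℕ) (S : St)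
    (pc t : ℕ) :
    execInstr O input (S.config pc t) i =
      PMF.pure ((i.effect input S).config (pc + 1) (t + 1)) := by
  cases i <;> first | rfl | exact h.elim

/-- Structured programs. `ite a s t` executes `s` if `mem[a] = 0` and `t` otherwise, `loop a s`
repeats `s` as long as `mem[a] ≠ 0`, and `call a` is a call with `λ = mem[a]` which leaves the
program in the case of failure. -/
inductive Cmd where
  | block (L : List Instr)
  | seq (s t : Cmd)
  | ite (a : ℕ) (s t : Cmd)
  | loop (a : ℕ) (s : Cmd)
  | call (a : ℕ)

namespace Cmd

/-- The length of the compiled program. -/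
def size : Cmd → ℕ
  | block L => L.length
  | seq s t => s.size + t.size
  | ite _ s t => t.size + 1 + s.size + 1
  | .loop _ s => s.size + 1 + 1
  | call _ => 2

/-- The program for a structured program, placed at position `o`. Cell `1` is assumed to
contain `0`, so that a conditional jump on it is unconditional. -/
def compile : Cmd → ℕ → List Instr
  | block L, _ => L
  | seq s t, o => s.compile o ++ t.compile (o + s.size)
  | ite a s t, o =>
      .jz a (o + t.size + 2) ::
        (t.compile (o + 1) ++ .jz 1 (o + t.size + 2 + s.size) :: s.compile (o + t.size + 2))
  | .loop a s, o => .jz a (o + s.size + 2) :: (s.compile (o + 1) ++ [.jz 1 o])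
  | call a, _ => [.call 0 a, .jz 0 exitPos]

lemma length_compile (s : Cmd) (o : ℕ) : (s.compile o).length = s.size := by
  induction s generalizing o with
  | block L => rfl
  | seq s t hs ht => simp [compile, size, hs, ht]
  | ite a s t hs ht => simp [compile, size, hs, ht]; omega
  | loop a s hs => simp [compile, size, hs]
  | call a => rfl

end Cmd

/-- From data `S` the structured program `s` leads to data `S'` within time `B`, if all oracle calls
succeed, and the failure probabilities of these calls sum up to at most `f`. -/
def Runs (input : List ℕ) (s : Cmd) (S S' : St) (B : ℕ) (f : ℝ) : Prop :=
  ∀ (Q : Program) (o : ℕ), SitsAt Q o (s.compile o) → ∀ t, ∃ t' ≤ t + B,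
    Q.Path input (S.config o t) (S'.config (o + s.size) t') f

lemma Program.Path.jz {Q : Program} {input : List ℕ} {S : St} {a o o' u t : ℕ}
    (h : Q[o]? = some (.jz a u)) (ho : o' = if S.mem a = 0 then u else o + 1) :
    Q.Path input (S.config o t) (S.config o' (t + 1)) 0 := by
  refine .step (c₂ := S.config o' (t + 1)) (fun O => ?_) (Nat.lt_succ_self t) (.refl _)
  unfold Program.step
  subst ho
  simp only [St.config, h, execInstr]
  rfl

namespace Runs

variable {input : List ℕ} {s s₁ s₂ : Cmd} {S S₁ S₂ S₃ S' : St} {B B₁ B₂ a : ℕ} {f f₁ f₂ : ℝ}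

lemma mono (h : Runs input s S S' B₁ f₁) (hB : B₁ ≤ B) (hf : f₁ = f) :
    Runs input s S S' B f := fun Q o hQ t =>
  let ⟨t', ht, hp⟩ := h Q o hQ t
  ⟨t', ht.trans (by omega), hf ▸ hp⟩

lemma block {L : List Instr} (hL : ∀ i ∈ L, i.Simple)
    (h : L.foldl (Instr.effect input) S = S') : Runs input (.block L) S S' L.length 0 := by
  subst h
  intro Q o hQ t
  refine ⟨t + L.length, le_rfl, ?_⟩
  simp only [Cmd.compile, Cmd.size] at hQ ⊢
  induction L generalizing S o t with
  | nil => exact .refl _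
  | cons i L ih =>
    have := ih (S := i.effect input S) (fun j hj => hL j (List.mem_cons_of_mem _ hj)) (o + 1)
      hQ.tail (t + 1)
    rw [List.length_cons, ← add_assoc, add_right_comm, ← add_assoc, add_right_comm t]
    refine .step (c₂ := (i.effect input S).config (o + 1) (t + 1)) (fun O => ?_)
      (Nat.lt_succ_self t) this
    unfold Program.step
    simp only [St.config, hQ.head]
    exact (hL i List.mem_cons_self).execInstr O input S o t

lemma seq (h₁ : Runs input s₁ S₁ S₂ B₁ f₁) (h₂ : Runs input s₂ S₂ S₃ B₂ f₂) :
    Runs input (.seq s₁ s₂) S₁ S₃ (B₁ + B₂) (f₁ + f₂) := by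
  intro Q o hQ t
  rw [Cmd.compile] at hQ
  obtain ⟨t', ht', hp⟩ := h₁ Q o hQ.left t
  have hr := hQ.right
  rw [Cmd.length_compile] at hr
  obtain ⟨t'', ht'', hp'⟩ := h₂ Q _ hr t'
  exact ⟨t'', by omega, by simpa [Cmd.size, add_assoc] using hp.trans hp'⟩

lemma ite_zero (ha : S.mem a = 0) (h : Runs input s₁ S S' B f) :
    Runs input (.ite a s₁ s₂) S S' (B + 1) f := by
  intro Q o hQ t
  rw [Cmd.compile] at hQ
  have hr := hQ.tail.right.tail
  rw [Cmd.length_compile, show o + 1 + s₂.size + 1 = o + s₂.size + 2 by ring] at hr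
  obtain ⟨t', ht', hp⟩ := h Q _ hr (t + 1)
  refine ⟨t', by omega, ?_⟩
  have := (Program.Path.jz (S := S) (input := input) (t := t) hQ.head (by rw [if_pos ha])).trans hp
  rw [zero_add] at this
  convert this using 2
  simp only [Cmd.size]; ring

lemma ite_pos (ha : S.mem a ≠ 0) (h1 : S'.mem 1 = 0) (h : Runs input s₂ S S' B f) :
    Runs input (.ite a s₁ s₂) S S' (B + 2) f := by
  intro Q o hQ t
  rw [Cmd.compile] at hQ
  obtain ⟨t', ht', hp⟩ := h Q _ hQ.tail.left (t + 1)
  refine ⟨t' + 1, by omega, ?_⟩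
  have hr := hQ.tail.right.head
  rw [Cmd.length_compile] at hr
  have h2 := (Program.Path.jz (S := S) (input := input) (t := t) hQ.head
    (by rw [if_neg ha])).trans hp
  have := h2.trans (Program.Path.jz (S := S') (input := input) (t := t') hr (by rw [if_pos h1]))
  rw [zero_add, add_zero] at this
  convert this using 2
  simp only [Cmd.size]; ring

lemma while_zero (ha : S.mem a = 0) : Runs input (.loop a s) S S 1 0 := by
  intro Q o hQ t
  rw [Cmd.compile] at hQ
  refine ⟨t + 1, le_rfl, ?_⟩
  exact Program.Path.jz hQ.head (by rw [if_pos ha]; simp only [Cmd.size]; ring)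

lemma while_succ (ha : S₁.mem a ≠ 0) (h1 : S₂.mem 1 = 0) (h : Runs input s S₁ S₂ B₁ f₁)
    (h' : Runs input (.loop a s) S₂ S₃ B₂ f₂) :
    Runs input (.loop a s) S₁ S₃ (B₁ + 2 + B₂) (f₁ + f₂) := by
  intro Q o hQ t
  have hQ' := hQ
  rw [Cmd.compile] at hQ
  obtain ⟨t', ht', hp⟩ := h Q _ hQ.tail.left (t + 1)
  have hr := hQ.tail.right.head
  rw [Cmd.length_compile] at hr
  obtain ⟨t'', ht'', hp'⟩ := h' Q o hQ' (t' + 1)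
  refine ⟨t'', by omega, ?_⟩
  have h2 := (Program.Path.jz (S := S₁) (input := input) (t := t) hQ.head
    (by rw [if_neg ha])).trans hp
  have h3 := h2.trans (Program.Path.jz (S := S₂) (input := input) (t := t') hr (by rw [if_pos h1]))
  simpa using h3.trans hp'

/-- The rule for counting loops; `I j` are the data after `j` rounds. -/
lemma for_loop (n B : ℕ) (I : ℕ → St) (f : ℕ → ℝ) (hc : ∀ j ≤ n, (I j).mem a = n - j)
    (h1 : ∀ j ≤ n, (I j).mem 1 = 0)
    (hs : ∀ j < n, Runs input s (I j) (I (j + 1)) B (f j)) :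
    Runs input (.loop a s) (I 0) (I n) (n * (B + 2) + 1) (∑ j ∈ Finset.range n, f j) := by
  suffices ∀ m i, i + m = n → Runs input (.loop a s) (I i) (I n) (m * (B + 2) + 1)
      (∑ j ∈ Finset.range m, f (i + j)) by simpa using this n 0 (by omega)
  intro m
  induction m with
  | zero =>
    intro i hi
    obtain rfl : i = n := by omega
    simpa using while_zero (by rw [hc i le_rfl]; omega)
  | succ m ih =>
    intro i hi
    have h := ih (i + 1) (by omega)
    have := while_succ (by rw [hc i (by omega)]; omega) (h1 (i + 1) (by omega)) (hs i (by omega)) h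
    rw [Finset.sum_range_succ']
    rw [add_comm] at this
    simp only [add_assoc, add_comm 1, add_zero] at this ⊢
    rw [add_comm (f i)] at this
    exact this.mono (by ring_nf; omega) rfl

/-- A successful call. -/
lemma call (e : ℝ) (he : 1 - OIQuery.successProb ⟨S.circuits, S.reg, S.mem a⟩ S.state ≤ e) :
    Runs input (.call a) S
      ⟨Function.update S.mem 0 1, [], ∅,
        QVec.normalize (OIQuery.OI ⟨S.circuits, S.reg, S.mem a⟩ S.state)⟩
      (2 + OIQuery.cost ⟨S.circuits, S.reg, S.mem a⟩) e := by
  intro Q o hQ t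
  rw [Cmd.compile] at hQ
  refine ⟨t + (2 + OIQuery.cost ⟨S.circuits, S.reg, S.mem a⟩), le_rfl, ?_⟩
  · rw [← add_zero e, show t + (2 + OIQuery.cost ⟨S.circuits, S.reg, S.mem a⟩) =
      t + 1 + OIQuery.cost ⟨S.circuits, S.reg, S.mem a⟩ + 1 by ring]
    refine .call hQ.head hQ.tail.head he ?_
    exact Program.Path.jz (S := ⟨Function.update S.mem 0 1, [], ∅,
        QVec.normalize (OIQuery.OI ⟨S.circuits, S.reg, S.mem a⟩ S.state)⟩)
      (input := input) hQ.tail.head (by simp [Cmd.size, St.config])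

end Runs

/-! ### Norms of vectors of amplitudes -/

namespace QVec

variable {φ ψ : QVec} {c : ℝ}

lemma normSq_eq_sum {A : Finset Ket} (h : ψ.support ⊆ A) : normSq ψ = ∑ s ∈ A, ‖ψ s‖ ^ 2 :=
  Finsupp.sum_of_support_subset ψ h _ fun _ _ => by simp

lemma norm_nonneg (ψ : QVec) : 0 ≤ norm ψ := Real.sqrt_nonneg _

lemma normSq_pos (h : ψ ≠ 0) : 0 < normSq ψ := by
  obtain ⟨s, hs⟩ := Finsupp.support_nonempty_iff.2 h
  exact Finset.sum_pos (fun s hs => by have := Finsupp.mem_support_iff.1 hs; positivity) ⟨s, hs⟩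

lemma norm_pos (h : ψ ≠ 0) : 0 < norm ψ := Real.sqrt_pos.2 (normSq_pos h)

lemma norm_mono (h : ∀ s, ‖φ s‖ ≤ ‖ψ s‖) : norm φ ≤ norm ψ := by
  refine Real.sqrt_le_sqrt ?_
  rw [normSq_eq_sum (Finset.subset_union_left (s₂ := ψ.support)),
    normSq_eq_sum (Finset.subset_union_right (s₁ := φ.support))]
  gcongr with s
  exact h s

lemma normSq_smul (z : ℂ) (ψ : QVec) : normSq (z • ψ) = ‖z‖ ^ 2 * normSq ψ := by
  rw [normSq_eq_sum Finsupp.support_smul, normSq_eq_sum subset_rfl, Finset.mul_sum]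
  simp [mul_pow]

lemma norm_smul (hc : 0 ≤ c) (ψ : QVec) : norm ((c : ℂ) • ψ) = c * norm ψ := by
  rw [norm, normSq_smul, Real.sqrt_mul (sq_nonneg _), Complex.norm_of_nonneg hc, Real.sqrt_sq hc,
    norm]

lemma normalize_smul (hc : 0 < c) (ψ : QVec) : normalize ((c : ℂ) • ψ) = normalize ψ := by
  rw [normalize, norm_smul hc.le, smul_smul, ← Complex.ofReal_mul, normalize]
  congr 3
  field_simp

lemma norm_normalize (h : ψ ≠ 0) : norm (normalize ψ) = 1 := by
  have := norm_pos h
  rw [normalize, norm_smul (inv_nonneg.2 this.le), inv_mul_cancel₀ this.ne']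

lemma normSq_mapDomain {f : Ket → Ket} (hf : Function.Injective f) (ψ : QVec) :
    normSq (Finsupp.mapDomain f ψ) = normSq ψ :=
  Finsupp.sum_mapDomain_index_inj hf

lemma norm_mapDomain {f : Ket → Ket} (hf : Function.Injective f) (ψ : QVec) :
    norm (Finsupp.mapDomain f ψ) = norm ψ := by
  rw [norm, normSq_mapDomain hf, norm]

lemma normalize_mapDomain {f : Ket → Ket} (hf : Function.Injective f) (ψ : QVec) :
    normalize (Finsupp.mapDomain f ψ) = Finsupp.mapDomain f (normalize ψ) := by
  rw [normalize, norm_mapDomain hf, normalize, Finsupp.mapDomain_smul]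

lemma normalize_nonneg (h : ∀ s, 0 ≤ ψ s) (s : Ket) : 0 ≤ normalize ψ s :=
  mul_nonneg (Complex.zero_le_real.2 (inv_nonneg.2 (norm_nonneg ψ))) (h s)

lemma mapDomain_nonneg {f : Ket → Ket} (hf : Function.Injective f) (h : ∀ s, 0 ≤ ψ s) (s : Ket) :
    0 ≤ Finsupp.mapDomain f ψ s := by
  by_cases hs : s ∈ Set.range f
  · obtain ⟨u, rfl⟩ := hs
    rw [Finsupp.mapDomain_apply hf]; exact h u
  · rw [Finsupp.mapDomain_of_notMem_range _ _ hs]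

end QVec

/-! ### Uniform superpositions -/

/-- The sum of the basis states in a multiset. -/
def ketSum (L : Multiset Ket) : QVec := (L.map fun s => Finsupp.single s (1 : ℂ)).sum

lemma ketSum_add (L L' : Multiset Ket) : ketSum (L + L') = ketSum L + ketSum L' := by
  simp [ketSum]

lemma ketSum_cons (s : Ket) (L : Multiset Ket) :
    ketSum (s ::ₘ L) = Finsupp.single s 1 + ketSum L := by
  simp [ketSum]

lemma ketSum_apply (L : Multiset Ket) (s : Ket) : ketSum L s = L.count s := by
  induction L using Multiset.induction with
  | empty => simp [ketSum]
  | cons t L ih =>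
    rw [ketSum_cons, Finsupp.add_apply, ih, Multiset.count_cons, Finsupp.single_apply]
    by_cases h : s = t
    · simp [h, add_comm]
    · simp [h, Ne.symm h]

lemma ketSum_ne_zero {L : Multiset Ket} (hL : L ≠ 0) : ketSum L ≠ 0 := by
  obtain ⟨s, hs⟩ := Multiset.exists_mem_of_ne_zero hL
  intro h
  have := ketSum_apply L s
  rw [h, Finsupp.zero_apply] at this
  exact (Multiset.count_pos.2 hs).ne' (by exact_mod_cast this.symm)

lemma mapDomain_ketSum (f : Ket → Ket) (L : Multiset Ket) :
    Finsupp.mapDomain f (ketSum L) = ketSum (L.map f) := by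
  induction L using Multiset.induction with
  | empty => simp [ketSum]
  | cons s L ih =>
    rw [ketSum_cons, Finsupp.mapDomain_add, ih, Multiset.map_cons, ketSum_cons,
      Finsupp.mapDomain_single]

/-- The normalized sum of the basis states in a multiset. -/
def uniform (L : Multiset Ket) : QVec := QVec.normalize (ketSum L)

lemma uniform_eq (L : Multiset Ket) :
    uniform L = (((QVec.norm (ketSum L))⁻¹ : ℝ) : ℂ) • ketSum L := rfl

lemma uniform_ne_zero {L : Multiset Ket} (hL : L ≠ 0) : uniform L ≠ 0 := by
  refine smul_ne_zero ?_ (ketSum_ne_zero hL)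
  exact_mod_cast inv_ne_zero (QVec.norm_pos (ketSum_ne_zero hL)).ne'

lemma uniform_nonneg (L : Multiset Ket) (s : Ket) : 0 ≤ uniform L s :=
  QVec.normalize_nonneg (fun s => by rw [ketSum_apply]; exact_mod_cast Nat.zero_le _) s

/-! ### Gates that permute the basis states -/

/-- The image of a basis state under a gate that permutes the basis states. -/
def Gate.move : Gate → Ket → Ket
  | .X a, s => Gate.flip a s
  | .CNOT a b, s => if a ∈ s then Gate.flip b s else s
  | .SWAP a b, s => s.image (Equiv.swap a b)
  | .Tof a b c, s => if a ∈ s ∧ b ∈ s then Gate.flip c s else s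
  | _, s => s

/-- The gate has distinct labels and permutes the basis states. -/
def Gate.Classical : Gate → Prop
  | .X _ => True
  | .CNOT a b => a ≠ b
  | .SWAP a b => a ≠ b
  | .Tof a b c => a ≠ b ∧ a ≠ c ∧ b ≠ c
  | _ => False

lemma Gate.mem_flip {a x : ℕ} {s : Ket} : x ∈ Gate.flip a s ↔ (x = a ↔ x ∉ s) := by
  unfold Gate.flip
  split_ifs with h
  · by_cases hx : x = a <;> simp [hx, h]
  · by_cases hx : x = a <;> simp [hx, h]

lemma Gate.flip_flip (a : ℕ) (s : Ket) : Gate.flip a (Gate.flip a s) = s := by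
  ext x; simp only [Gate.mem_flip]; tauto

lemma mem_image_swap {a b x : ℕ} {s : Finset ℕ} :
    x ∈ s.image (Equiv.swap a b) ↔ Equiv.swap a b x ∈ s := by
  rw [Finset.mem_image]
  constructor
  · rintro ⟨y, hy, rfl⟩; simpa using hy
  · exact fun h => ⟨_, h, by simp⟩

lemma Gate.Classical.move_move {g : Gate} (hg : g.Classical) (s : Ket) : g.move (g.move s) = s := by
  cases g with
  | X a => exact Gate.flip_flip a s
  | CNOT a b =>
    simp only [Gate.Classical] at hg
    by_cases h : a ∈ s
    · have : a ∈ Gate.flip b s := by rw [Gate.mem_flip]; tauto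
      simp [Gate.move, h, this, Gate.flip_flip]
    · simp [Gate.move, h]
  | SWAP a b =>
    ext x; simp [Gate.move, -Finset.mem_image, mem_image_swap]
  | Tof a b c =>
    obtain ⟨-, hac, hbc⟩ := hg
    by_cases h : a ∈ s ∧ b ∈ s
    · have : a ∈ Gate.flip c s ∧ b ∈ Gate.flip c s := by
        rw [Gate.mem_flip, Gate.mem_flip]; tauto
      simp [Gate.move, h, this, Gate.flip_flip]
    · simp [Gate.move, h]
  | _ => exact hg.elim

lemma Gate.Classical.apply {g : Gate} (hg : g.Classical) (ψ : QVec) :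
    g.apply ψ = Finsupp.mapDomain g.move ψ := by
  have hv : g.Valid := by
    cases g <;> first | exact hg | trivial
  have : g.onKet = fun s => Finsupp.single (g.move s) 1 := by
    funext s
    cases g <;> first | rfl | exact hg.elim
  rw [Gate.apply, if_pos hv, Finsupp.linearCombination_apply, this, Finsupp.mapDomain]
  simp

/-- The image of a basis state under a circuit of gates that permute the basis states. -/
def QCircuit.move (U : QCircuit) (s : Ket) : Ket := U.foldl (fun s g => g.move s) s

/-- All gates of the circuit permute the basis states. -/
def QCircuit.Classical (U : QCircuit) : Prop := ∀ g ∈ U, g.Classical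

namespace QCircuit

lemma move_cons (g : Gate) (U : QCircuit) (s : Ket) : move (g :: U) s = move U (g.move s) := rfl

lemma move_append (U V : QCircuit) (s : Ket) : move (U ++ V) s = move V (move U s) :=
  List.foldl_append

lemma apply_append (U V : QCircuit) (ψ : QVec) : apply (U ++ V) ψ = apply V (apply U ψ) :=
  List.foldl_append

variable {U V : QCircuit}

lemma Classical.append (hU : U.Classical) (hV : V.Classical) : Classical (U ++ V) := fun g hg =>
  (List.mem_append.1 hg).elim (hU g) (hV g)

lemma Classical.apply (hU : U.Classical) (ψ : QVec) :
    U.apply ψ = Finsupp.mapDomain U.move ψ := by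
  induction U generalizing ψ with
  | nil => exact Finsupp.mapDomain_id.symm
  | cons g U ih =>
    change QCircuit.apply U (g.apply ψ) = _
    rw [ih fun g' hg => hU g' (List.mem_cons_of_mem _ hg),
      (hU g List.mem_cons_self).apply, ← Finsupp.mapDomain_comp]
    rfl

lemma Classical.injective (hU : U.Classical) : Function.Injective U.move := by
  induction U with
  | nil => exact fun _ _ h => h
  | cons g U ih =>
    exact (ih fun g' hg => hU g' (List.mem_cons_of_mem _ hg)).comp
      (Function.LeftInverse.injective (hU g List.mem_cons_self).move_move)

lemma Classical.apply_uniform (hU : U.Classical) (L : Multiset Ket) :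
    U.apply (uniform L) = uniform (L.map U.move) := by
  rw [hU.apply, uniform, ← QVec.normalize_mapDomain hU.injective, mapDomain_ketSum, uniform]

/-- A circuit on the register `R` does not touch the qubits outside `R`. -/
lemma Classical.move_sdiff (hU : U.Classical) {R : Finset ℕ} (hR : ∀ g ∈ U, g.qubits ⊆ R)
    (s : Ket) : U.move s \ R = s \ R := by
  induction U generalizing s with
  | nil => rfl
  | cons g U ih =>
    rw [move_cons, ih (fun g' hg => hU g' (List.mem_cons_of_mem _ hg))
      fun g' hg => hR g' (List.mem_cons_of_mem _ hg)]
    have h := hR g List.mem_cons_self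
    have hc := hU g List.mem_cons_self
    have hflip : ∀ a ∈ R, Gate.flip a s \ R = s \ R := by
      intro a ha
      ext x
      simp only [Finset.mem_sdiff, Gate.mem_flip, and_congr_left_iff]
      intro hx
      have : x ≠ a := fun h => hx (h ▸ ha)
      tauto
    cases g with
    | X a => exact hflip a (h (by simp [Gate.qubits]))
    | CNOT a b =>
      simp only [Gate.move]
      split_ifs
      exacts [hflip b (h (by simp [Gate.qubits])), rfl]
    | SWAP a b =>
      ext x
      simp only [Finset.mem_sdiff, Gate.move, mem_image_swap, and_congr_left_iff]
      intro hx
      rw [Equiv.swap_apply_of_ne_of_ne]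
      · rintro rfl; exact hx (h (by simp [Gate.qubits]))
      · rintro rfl; exact hx (h (by simp [Gate.qubits]))
    | Tof a b c =>
      simp only [Gate.move]
      split_ifs
      exacts [hflip c (h (by simp [Gate.qubits])), rfl]
    | _ => exact hc.elim

end QCircuit

/-! ### Hadamard gates -/

lemma Gate.H_apply (q : ℕ) (ψ : QVec) :
    (Gate.H q).apply ψ = Finsupp.linearCombination ℂ (Gate.H q).onKet ψ := if_pos trivial

lemma Gate.H_ketSum (q : ℕ) (L : Multiset Ket) :
    (Gate.H q).apply (ketSum L) = (L.map (Gate.H q).onKet).sum := by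
  rw [Gate.H_apply]
  induction L using Multiset.induction with
  | empty => simp [ketSum]
  | cons s L ih => rw [ketSum_cons, map_add, ih]; simp

lemma Gate.H_smul (q : ℕ) (z : ℂ) (ψ : QVec) :
    (Gate.H q).apply (z • ψ) = z • (Gate.H q).apply ψ := by
  rw [Gate.H_apply, Gate.H_apply, map_smul]

section Hadamard

variable {q : ℕ} {L : Multiset Ket}

lemma Gate.H_ketSum_clean (h : ∀ s ∈ L, q ∉ s) :
    (Gate.H q).apply (ketSum L) =
      (((Real.sqrt 2)⁻¹ : ℝ) : ℂ) • ketSum (L + L.map (insert q)) := by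
  rw [Gate.H_ketSum]
  induction L using Multiset.induction with
  | empty => simp [ketSum]
  | cons s L ih =>
    have hs : q ∉ s := h s (Multiset.mem_cons_self s L)
    rw [Multiset.map_cons, Multiset.sum_cons, ih fun t ht => h t (Multiset.mem_cons_of_mem ht)]
    simp only [Gate.onKet, hs, if_false, Finset.erase_eq_of_notMem, not_false_eq_true, ketSum_add,
      Multiset.map_cons, ketSum_cons, one_mul, smul_add, Finsupp.smul_single, smul_eq_mul, mul_one]
    abel

lemma Gate.H_ketSum_plus (h : ∀ s ∈ L, q ∉ s) :
    (Gate.H q).apply (ketSum (L + L.map (insert q))) = ((Real.sqrt 2 : ℝ) : ℂ) • ketSum L := by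
  rw [Gate.H_ketSum]
  induction L using Multiset.induction with
  | empty => simp [ketSum]
  | cons s L ih =>
    have hs : q ∉ s := h s (Multiset.mem_cons_self s L)
    have ih := ih fun t ht => h t (Multiset.mem_cons_of_mem ht)
    have h2 : ((Real.sqrt 2 : ℝ) : ℂ) =
        (((Real.sqrt 2)⁻¹ : ℝ) : ℂ) + (((Real.sqrt 2)⁻¹ : ℝ) : ℂ) := by
      rw [← Complex.ofReal_add]
      congr 1
      field_simp
      norm_num
    rw [Multiset.map_add, Multiset.sum_add] at ih
    rw [Multiset.map_add, Multiset.sum_add, Multiset.map_cons, Multiset.map_cons, Multiset.map_cons,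
      Multiset.sum_cons, Multiset.sum_cons, add_add_add_comm, ih, ketSum_cons, smul_add]
    congr 1
    simp only [Gate.onKet, hs, if_false, Finset.erase_eq_of_notMem, not_false_eq_true,
      Finset.mem_insert_self, if_true, Finset.erase_insert, Finset.insert_idem, one_mul,
      Finsupp.smul_single, smul_eq_mul, mul_one, h2, Finsupp.single_add, neg_mul,
      Finsupp.single_neg]
    abel

lemma norm_ketSum_plus (h : ∀ s ∈ L, q ∉ s) :
    QVec.norm (ketSum (L + L.map (insert q))) = Real.sqrt 2 * QVec.norm (ketSum L) := by
  rw [QVec.norm, QVec.norm, ← Real.sqrt_mul zero_le_two]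
  congr 1
  have hnot : ∀ s ∈ (ketSum L).support, q ∉ s := by
    intro s hs
    rw [Finsupp.mem_support_iff, ketSum_apply] at hs
    exact h s (Multiset.count_ne_zero.1 (by exact_mod_cast hs))
  -- flipping `q` agrees with inserting `q` on the basis states that occur, and is injective
  have hmap : L.map (insert q) = L.map (Gate.flip q) :=
    Multiset.map_congr rfl fun s hs => by simp [Gate.flip, h s hs]
  have hinj : Function.Injective (Gate.flip q) := Function.LeftInverse.injective (Gate.flip_flip q)
  rw [hmap, ketSum_add, QVec.normSq, Finsupp.sum_add_index_of_disjoint, two_mul]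
  · congr 1
    rw [← mapDomain_ketSum]
    exact QVec.normSq_mapDomain hinj _
  · rw [Finset.disjoint_left]
    intro s hs hs'
    rw [Finsupp.mem_support_iff, ketSum_apply] at hs'
    have : s ∈ L.map (Gate.flip q) := Multiset.count_ne_zero.1 (by exact_mod_cast hs')
    obtain ⟨u, hu, rfl⟩ := Multiset.mem_map.1 this
    exact hnot _ hs (by simp [Gate.mem_flip, h u hu])

lemma Gate.H_uniform_clean (h : ∀ s ∈ L, q ∉ s) :
    (Gate.H q).apply (uniform L) = uniform (L + L.map (insert q)) := by
  rw [uniform, QVec.normalize, Gate.H_smul, Gate.H_ketSum_clean h, uniform, QVec.normalize,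
    norm_ketSum_plus h, smul_smul, mul_inv, ← Complex.ofReal_mul, mul_comm]

lemma Gate.H_uniform_plus (h : ∀ s ∈ L, q ∉ s) :
    (Gate.H q).apply (uniform (L + L.map (insert q))) = uniform L := by
  rw [uniform, QVec.normalize, Gate.H_smul, Gate.H_ketSum_plus h, uniform, QVec.normalize,
    norm_ketSum_plus h, smul_smul, ← Complex.ofReal_mul]
  congr 2
  have : Real.sqrt 2 ≠ 0 := by positivity
  field_simp

end Hadamard

/-! ### Oracle calls with circuits that permute the basis states -/

lemma eq_norm_of_nonneg {z : ℂ} (hz : 0 ≤ z) : z = (‖z‖ : ℂ) :=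
  Complex.eq_coe_norm_of_nonneg hz

lemma norm_sum_of_nonneg {ι : Type*} (A : Finset ι) {z : ι → ℂ} (hz : ∀ i ∈ A, 0 ≤ z i) :
    ‖∑ i ∈ A, z i‖ = ∑ i ∈ A, ‖z i‖ := by
  have : ∑ i ∈ A, z i = ((∑ i ∈ A, ‖z i‖ : ℝ) : ℂ) := by
    rw [Complex.ofReal_sum]
    exact Finset.sum_congr rfl fun i hi => eq_norm_of_nonneg (hz i hi)
  rw [this, Complex.norm_of_nonneg (Finset.sum_nonneg fun i _ => norm_nonneg _)]

namespace OIQuery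

variable {q : OIQuery}

lemma exists_ordered_eq_mapDomain (hq : q.Valid) (hc : ∀ U ∈ q.circuits, QCircuit.Classical U)
    (σ : Equiv.Perm (Fin q.circuits.length)) :
    ∃ f : Ket → Ket, Function.Injective f ∧ (∀ s, f s \ q.reg = s \ q.reg) ∧
      ∀ ψ, q.ordered σ ψ = Finsupp.mapDomain f ψ := by
  suffices ∀ (n : ℕ) (V : Fin n → QCircuit), (∀ i, V i ∈ q.circuits) →
      ∃ f : Ket → Ket, Function.Injective f ∧ (∀ s, f s \ q.reg = s \ q.reg) ∧
        ∀ ψ, Fin.foldl n (fun φ i => (V i).apply φ) ψ = Finsupp.mapDomain f ψ from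
    this _ (fun i => q.circuits.get (σ⁻¹ i)) fun i => List.get_mem _ _
  intro n
  induction n with
  | zero => exact fun V _ => ⟨id, Function.injective_id, fun _ => rfl, fun ψ => by simp⟩
  | succ n ih =>
    intro V hV
    obtain ⟨f, hf, hr, hm⟩ := ih (fun i => V i.castSucc) fun i => hV _
    have hcl := hc _ (hV (Fin.last n))
    refine ⟨(V (Fin.last n)).move ∘ f, hcl.injective.comp hf, fun s => ?_, fun ψ => ?_⟩
    · rw [Function.comp_apply, hcl.move_sdiff fun g hg => (hq.2.2.2 _ (hV _) g hg).2, hr]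
    · rw [Fin.foldl_succ_last, hm, hcl.apply, Finsupp.mapDomain_comp]

/-- If the circuits permute the basis states and the amplitudes are nonnegative, then nothing
cancels: the phases are aligned, and the interference vector is at least as long as each of its
summands. -/
lemma le_successProb (hq : q.Valid) (hc : ∀ U ∈ q.circuits, QCircuit.Classical U) {ψ : QVec}
    (h0 : ψ ≠ 0) (hψ : ∀ s, 0 ≤ ψ s) :
    (1 / (q.circuits.length.factorial : ℝ)) /
      (1 / (q.circuits.length.factorial : ℝ) + 1 / (q.lam : ℝ)) ≤ q.successProb ψ := by
  choose f hf hr hm using exists_ordered_eq_mapDomain hq hc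
  rw [successProb, if_pos hq]
  have hne : Nonempty (q.branches ψ) := by
    obtain ⟨s, hs⟩ := Finsupp.support_nonempty_iff.2 h0
    exact ⟨⟨_, Finset.mem_image_of_mem _ hs⟩⟩
  refine le_ciInf fun ⟨y, hy⟩ => ?_
  obtain ⟨s₀, hs₀, rfl⟩ := Finset.mem_image.1 hy
  set y := s₀ \ q.reg with hy'
  set β := q.branch ψ y with hβ
  have hF : Finsupp.filter (fun s : Ket => s \ q.reg = y) ψ ≠ 0 := by
    intro h
    have := DFunLike.congr_fun h s₀
    rw [Finsupp.filter_apply_pos (fun s : Ket => s \ q.reg = y) _ hy'.symm] at this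
    exact Finsupp.mem_support_iff.1 hs₀ this
  have hβ1 : QVec.norm β = 1 := QVec.norm_normalize hF
  have hβ0 : ∀ s, 0 ≤ β s := QVec.normalize_nonneg fun s => by
    rw [Finsupp.filter_apply]; split_ifs; exacts [hψ s, le_rfl]
  have hnn : ∀ σ s, 0 ≤ q.ordered σ β s := fun σ s => by
    rw [hm]; exact QVec.mapDomain_nonneg (hf σ) hβ0 s
  have hβs : β s₀ ≠ 0 := by
    rw [hβ, branch, QVec.normalize, Finsupp.smul_apply, smul_eq_mul,
      Finsupp.filter_apply_pos (fun s : Ket => s \ q.reg = y) _ hy'.symm]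
    refine mul_ne_zero ?_ (Finsupp.mem_support_iff.1 hs₀)
    exact_mod_cast inv_ne_zero (QVec.norm_pos hF).ne'
  have halign : q.alignment ψ y = 1 := by
    rw [alignment, ← hβ]
    have hpos : 0 < ∑ x ∈ q.reg.powerset, ∑ σ : Equiv.Perm (Fin q.circuits.length),
        ‖q.ordered σ β (x ∪ y)‖ := by
      refine Finset.sum_pos' (fun x _ => Finset.sum_nonneg fun σ _ => norm_nonneg _)
        ⟨f 1 s₀ ∩ q.reg, Finset.mem_powerset.2 Finset.inter_subset_right, ?_⟩
      refine Finset.sum_pos' (fun σ _ => norm_nonneg _) ⟨1, Finset.mem_univ _, ?_⟩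
      rw [hy', ← hr 1 s₀, Finset.union_comm, Finset.sdiff_union_inter, hm,
        Finsupp.mapDomain_apply (hf 1)]
      exact norm_pos_iff.2 hβs
    rw [div_eq_one_iff_eq hpos.ne']
    exact Finset.sum_congr rfl fun x _ => norm_sum_of_nonneg _ fun σ _ => hnn σ _
  have hnorm : 1 ≤ QVec.norm (q.OI β) := by
    rw [← hβ1, ← QVec.norm_mapDomain (hf 1) β, ← hm]
    -- compare with the summand for the identity order, whose length is `1`
    refine QVec.norm_mono fun s => ?_
    rw [OI, Finsupp.finsetSum_apply, norm_sum_of_nonneg _ fun σ _ => hnn σ s]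
    exact Finset.single_le_sum (f := fun σ => ‖q.ordered σ β s‖) (fun σ _ => norm_nonneg _)
      (Finset.mem_univ _)
  have hs : 1 / (q.circuits.length.factorial : ℝ) ≤ q.scaledNorm ψ y := by
    rw [scaledNorm]; gcongr
  have hm0 : 0 < 1 / (q.circuits.length.factorial : ℝ) := by positivity
  have hl0 : 0 < 1 / (q.lam : ℝ) := by have := hq.2.2.1; positivity
  change _ ≤ q.alignment ψ y * (q.scaledNorm ψ y / (q.scaledNorm ψ y + 1 / (q.lam : ℝ)))
  rw [halign, one_mul, div_le_div_iff₀ (by positivity) (by linarith)]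
  nlinarith

end OIQuery

/-! ### Erasing a uniformly random qubit -/

/-- The call that interferes `X a` and `CNOT a b`: if qubit `a` is `0`, the two orders act on `b`
as the identity and as `X`, so the call projects `b` onto the uniform superposition. -/
def eraseQuery (a b lam : ℕ) : OIQuery := ⟨[[.CNOT a b], [.X a]], {b, a}, lam⟩

section Erase

variable {a b lam : ℕ} {L : Multiset Ket}

lemma one_sub_successProb_eraseQuery_le (hab : a ≠ b) (hl : 0 < lam) (hL : L ≠ 0) :
    1 - (eraseQuery a b lam).successProb (uniform L) ≤ 2 / lam := by
  have h := OIQuery.le_successProb (q := eraseQuery a b lam)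
    ⟨by simp [eraseQuery], by simp [eraseQuery], hl, by
      simp [eraseQuery, Gate.qubits, Gate.Valid, hab, Finset.subset_iff]⟩
    (by simp [eraseQuery, QCircuit.Classical, Gate.Classical, hab])
    (uniform_ne_zero hL) (uniform_nonneg L)
  have hl' : (0 : ℝ) < lam := by exact_mod_cast hl
  have e : ((eraseQuery a b lam).circuits.length.factorial : ℝ) = 2 := by simp [eraseQuery]
  have e' : ((eraseQuery a b lam).lam : ℝ) = lam := rfl
  rw [e, e'] at h
  have : (1 : ℝ) - 2 / lam ≤ 1 / 2 / (1 / 2 + 1 / lam) := by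
    rw [le_div_iff₀ (by positivity)]
    have : 0 < (1 : ℝ) / lam := by positivity
    rw [show (2 : ℝ) / lam = 2 * (1 / lam) by ring]
    nlinarith
  linarith

lemma OI_eraseQuery (ψ : QVec) :
    (eraseQuery a b lam).OI ψ =
      QCircuit.apply [.CNOT a b, .X a] ψ + QCircuit.apply [.X a, .CNOT a b] ψ := by
  have h : (Finset.univ : Finset (Equiv.Perm (Fin 2))) = {1, Equiv.swap 0 1} := by decide
  change ∑ σ : Equiv.Perm (Fin 2), (eraseQuery a b lam).ordered σ ψ = _
  rw [h, Finset.sum_pair (by decide)]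
  rfl

lemma normalize_OI_eraseQuery (hab : a ≠ b) (hL : ∀ s ∈ L, a ∉ s) :
    QVec.normalize ((eraseQuery a b lam).OI (uniform L)) =
      uniform ((L + L.map (Gate.flip b)).map (Gate.flip a)) := by
  rcases eq_or_ne L 0 with rfl | hL0
  · have h0 : uniform 0 = 0 := by simp [uniform, ketSum, QVec.normalize]
    rw [OI_eraseQuery, QCircuit.Classical.apply, QCircuit.Classical.apply]
    · simp [h0, QVec.normalize]
    all_goals simp [QCircuit.Classical, Gate.Classical, hab]
  have hpos : 0 < (QVec.norm (ketSum L))⁻¹ := inv_pos.2 (QVec.norm_pos (ketSum_ne_zero hL0))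
  rw [OI_eraseQuery, QCircuit.Classical.apply, QCircuit.Classical.apply, uniform_eq,
    Finsupp.mapDomain_smul, Finsupp.mapDomain_smul, ← smul_add, QVec.normalize_smul hpos,
    mapDomain_ketSum, mapDomain_ketSum, ← ketSum_add, uniform, Multiset.map_add, Multiset.map_map]
  · congr 3
    · refine Multiset.map_congr rfl fun s hs => ?_
      simp [QCircuit.move, Gate.move, hL s hs]
    · refine Multiset.map_congr rfl fun s hs => ?_
      have : a ∈ Gate.flip a s := by simp [Gate.mem_flip, hL s hs]
      simp only [QCircuit.move, Gate.move, List.foldl_cons, List.foldl_nil, this, if_true,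
        Function.comp_apply]
      ext x
      simp only [Gate.mem_flip]
      tauto
  all_goals simp [QCircuit.Classical, Gate.Classical, hab]

/-- Interference leaves `b` in the uniform superposition, whatever it was before; this is the state
that a Hadamard gate returns to `0`. -/
lemma H_X_normalize_OI_eraseQuery (hab : a ≠ b) (hL : ∀ s ∈ L, a ∉ s) :
    (Gate.H b).apply ((Gate.X a).apply
      (QVec.normalize ((eraseQuery a b lam).OI (uniform L)))) =
      uniform (L.map fun s => s.erase b) := by
  have hX : QCircuit.Classical [.X a] := by simp [QCircuit.Classical, Gate.Classical]
  have h1 : ∀ ψ, (Gate.X a).apply ψ = QCircuit.apply [.X a] ψ := fun ψ => rfl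
  rw [normalize_OI_eraseQuery hab hL, h1, hX.apply_uniform, Multiset.map_map]
  have h2 : (QCircuit.move [.X a] ∘ Gate.flip a) = id := funext fun s => Gate.flip_flip a s
  rw [h2, Multiset.map_id]
  have h3 : L + L.map (Gate.flip b) =
      L.map (fun s => s.erase b) + (L.map fun s => s.erase b).map (insert b) := by
    clear hL
    induction L using Multiset.induction with
    | empty => rfl
    | cons s L ih =>
      simp only [Multiset.map_cons, Multiset.cons_add, Multiset.add_cons, ih]
      by_cases hs : b ∈ s
      · rw [Gate.flip, if_pos hs, Multiset.cons_swap, Finset.insert_erase hs]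
      · rw [Gate.flip, if_neg hs, Finset.erase_eq_of_notMem hs]
  rw [h3, Gate.H_uniform_plus]
  intro s hs
  obtain ⟨u, -, rfl⟩ := Multiset.mem_map.1 hs
  exact Finset.notMem_erase b u

end Erase

/-! ### Basis states that hold a data register and the wires of a circuit -/

/-- The value of qubit `a` if the first qubits hold the data `d`, the next one is `0`, and the
remaining ones hold `w`, followed by zeros. -/
def layout (d w : List Bool) (a : ℕ) : Bool :=
  if a < d.length then d.getD a false
  else if a = d.length then false else w.getD (a - (d.length + 1)) false

/-- The basis state in which the first qubits hold the data `d`, the next one is `0`, and the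
remaining ones hold `w`, followed by zeros. -/
def ket (d w : List Bool) : Ket :=
  (Finset.range (d.length + 1 + w.length)).filter fun a => layout d w a

lemma mem_ket {d w : List Bool} {a : ℕ} : a ∈ ket d w ↔ layout d w a = true := by
  rw [ket, Finset.mem_filter, and_iff_right_iff_imp, Finset.mem_range]
  intro h
  by_contra hlt
  rw [layout, if_neg (by omega), if_neg (by omega), List.getD_eq_default _ _ (by omega)] at h
  exact absurd h (by decide)

lemma mem_ket_wire {d w : List Bool} {i : ℕ} :
    d.length + 1 + i ∈ ket d w ↔ w.getD i false = true := by
  rw [mem_ket, layout, if_neg (by omega), if_neg (by omega),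
    show d.length + 1 + i - (d.length + 1) = i by omega]

lemma length_notMem_ket {d w : List Bool} : d.length ∉ ket d w := by
  rw [mem_ket, layout, if_neg (by omega), if_pos rfl]; decide

lemma ket_congr {d w w' : List Bool} (h : ∀ i, w.getD i false = w'.getD i false) :
    ket d w = ket d w' := by
  ext a; rw [mem_ket, mem_ket, layout, layout, h]

lemma ket_append_false (d w : List Bool) : ket d (w ++ [false]) = ket d w := by
  refine ket_congr fun i => ?_
  rcases lt_trichotomy i w.length with h | rfl | h
  · rw [List.getD_append _ _ _ _ h]
  · simp
  · rw [List.getD_eq_default _ _ (by simp; omega), List.getD_eq_default _ _ (by omega)]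

lemma ket_replicate_false (d : List Bool) (n : ℕ) : ket d (List.replicate n false) = ket d [] :=
  ket_congr fun i => by
    rw [List.getD_eq_default [] _ (by simp), List.getD_eq_getElem?_getD, List.getElem?_replicate]
    split_ifs <;> rfl

lemma flip_ket_wire (d w : List Bool) (b : Bool) :
    Gate.flip (d.length + 1 + w.length) (ket d (w ++ [b])) = ket d (w ++ [!b]) := by
  ext a
  rw [Gate.mem_flip]
  by_cases h : a = d.length + 1 + w.length
  · subst h
    rw [mem_ket_wire, mem_ket_wire]
    simp
  · simp only [h, false_iff, not_not]
    rw [mem_ket, mem_ket, layout, layout]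
    split_ifs with h1 h2
    · rfl
    · rfl
    · rcases lt_or_gt_of_ne h with h3 | h3
      · rw [List.getD_append _ _ _ _ (by omega), List.getD_append _ _ _ _ (by omega)]
      · rw [List.getD_eq_default _ _ (by simp; omega), List.getD_eq_default _ _ (by simp; omega)]

lemma insert_ket_wire (d w : List Bool) :
    insert (d.length + 1 + w.length) (ket d w) = ket d (w ++ [true]) := by
  have h := flip_ket_wire d w false
  rw [ket_append_false] at h
  rw [← Bool.not_false, ← h, Gate.flip, if_neg]
  rw [mem_ket_wire]
  simp

lemma flip_ket_data (d d' w : List Bool) (b : Bool) :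
    Gate.flip d.length (ket (d ++ b :: d') w) = ket (d ++ (!b) :: d') w := by
  ext a
  rw [Gate.mem_flip, mem_ket, mem_ket, layout, layout]
  simp only [List.length_append, List.length_cons]
  by_cases h : a = d.length
  · subst h
    simp
  · simp only [h, false_iff, not_not]
    have : (d ++ b :: d').getD a false = (d ++ (!b) :: d').getD a false := by
      rcases lt_or_gt_of_ne h with h3 | h3
      · rw [List.getD_append _ _ _ _ h3, List.getD_append _ _ _ _ h3]
      · rw [List.getD_append_right _ _ _ _ h3.le, List.getD_append_right _ _ _ _ h3.le]
        obtain ⟨m, hm⟩ : ∃ m, a - d.length = m + 1 := ⟨a - d.length - 1, by omega⟩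
        rw [hm]; rfl
    rw [this]

/-! ### Reversible evaluation of a classical circuit -/

/-- The circuit that adds the value of a classical gate to qubit `t`. Wire `i` is qubit `k+1+i`, and
qubit `k` is `0`; a copy of the second argument is kept there for a while, so that the Toffoli gate
has distinct labels even if the two arguments are the same wire. -/
def gateCircuit (k t : ℕ) : BGate → QCircuit
  | .not i => [.CNOT (k + 1 + i) t, .X t]
  | .and i j => [.CNOT (k + 1 + j) k, .Tof (k + 1 + i) k t, .CNOT (k + 1 + j) k]
  | .or i j => [.CNOT (k + 1 + i) t, .CNOT (k + 1 + j) t,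
      .CNOT (k + 1 + j) k, .Tof (k + 1 + i) k t, .CNOT (k + 1 + j) k]

lemma gateCircuit_classical (k : ℕ) {n : ℕ} {g : BGate} (hg : g.InRange n) :
    (gateCircuit k (k + 1 + n) g).Classical := by
  cases g <;> simp only [BGate.InRange] at hg <;>
    simp [gateCircuit, QCircuit.Classical, Gate.Classical] <;> omega

lemma move_and {k i j t : ℕ} {s : Ket} (hk : k ∉ s) (hi : i ≠ k) (hj : j ≠ k)
    (hjt : j ≠ t) :
    QCircuit.move [.CNOT j k, .Tof i k t, .CNOT j k] s =
      if i ∈ s ∧ j ∈ s then Gate.flip t s else s := by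
  simp only [QCircuit.move, Gate.move, List.foldl_cons, List.foldl_nil]
  by_cases h1 : i ∈ s <;> by_cases h2 : j ∈ s <;>
    simp only [h1, h2, if_true, if_false, Gate.mem_flip, hk, hi, hj, hjt,
      and_true, and_false, not_true_eq_false, not_false_eq_true, iff_true, Gate.flip_flip]
  -- only the case that both arguments are `1` is left
  ext x
  simp only [Gate.mem_flip]
  tauto

lemma move_gateCircuit {d w : List Bool} {g : BGate} (hg : g.InRange w.length) (b : Bool) :
    QCircuit.move (gateCircuit d.length (d.length + 1 + w.length) g) (ket d (w ++ [b])) =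
      ket d (w ++ [xor b (g.eval w)]) := by
  have hw : ∀ i < w.length,
      (d.length + 1 + i ∈ ket d (w ++ [b]) ↔ w.getD i false = true) := fun i hi => by
    rw [mem_ket_wire, List.getD_append _ _ _ _ hi]
  have hf : ∀ x : Bool, (if x = true then Gate.flip (d.length + 1 + w.length) (ket d (w ++ [b]))
      else ket d (w ++ [b])) = ket d (w ++ [xor b x]) := by
    intro x
    cases x
    · simp
    · simp [flip_ket_wire]
  cases g with
  | not i =>
    rw [BGate.InRange] at hg
    rw [BGate.eval, ← hf]
    simp only [gateCircuit, QCircuit.move, Gate.move, List.foldl_cons, List.foldl_nil, hw i hg]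
    cases w.getD i false <;> simp [Gate.flip_flip]
  | and i j =>
    obtain ⟨hi, hj⟩ := hg
    rw [gateCircuit, move_and length_notMem_ket (by omega) (by omega) (by omega), BGate.eval, ← hf]
    simp only [hw i hi, hw j hj, Bool.and_eq_true]
  | or i j =>
    obtain ⟨hi, hj⟩ := hg
    have h2 : ∀ b : Bool, (d.length + 1 + j ∈ ket d (w ++ [b]) ↔ w.getD j false = true) :=
      fun b => by rw [mem_ket_wire, List.getD_append _ _ _ _ hj]
    have h1 : ∀ b : Bool, (d.length + 1 + i ∈ ket d (w ++ [b]) ↔ w.getD i false = true) :=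
      fun b => by rw [mem_ket_wire, List.getD_append _ _ _ _ hi]
    rw [gateCircuit, QCircuit.move_cons, QCircuit.move_cons]
    simp only [Gate.move, hw i hi]
    rw [hf]
    simp only [h2]
    cases hi' : w.getD i false <;> cases hj' : w.getD j false <;>
      simp only [if_true, if_false, flip_ket_wire, Bool.false_eq_true] <;>
      rw [move_and length_notMem_ket (by omega) (by omega) (by omega)] <;>
      simp only [h1, h2, hi', hj', BGate.eval, flip_ket_wire, if_true, if_false, and_self, and_true,
        and_false, Bool.false_eq_true] <;> simp

/-- The wires after the evaluation of some gates. -/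
def evalGates (w : List Bool) (gs : List BGate) : List Bool :=
  gs.foldl (fun w g => w ++ [g.eval w]) w

/-- The gates are well-formed if there are `n` earlier wires. -/
def GatesWF (n : ℕ) (gs : List BGate) : Prop :=
  ∀ (t : ℕ) (h : t < gs.length), (gs[t]).InRange (n + t)

lemma GatesWF.cons {n : ℕ} {g : BGate} {gs : List BGate} (h : GatesWF n (g :: gs)) :
    g.InRange n ∧ GatesWF (n + 1) gs :=
  ⟨h 0 (by simp), fun t ht => by
    have := h (t + 1) (by simpa using ht)
    rwa [← add_assoc, add_right_comm] at this⟩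

lemma GatesWF.concat {n : ℕ} {g : BGate} {gs : List BGate} (h : GatesWF n (gs ++ [g])) :
    GatesWF n gs ∧ g.InRange (n + gs.length) :=
  ⟨fun t ht => by
    have := h t (by simp; omega)
    rwa [List.getElem_append_left ht] at this, by simpa using h gs.length (by simp)⟩

lemma length_evalGates (w : List Bool) (gs : List BGate) :
    (evalGates w gs).length = w.length + gs.length := by
  induction gs generalizing w with
  | nil => rfl
  | cons g gs ih =>
    have := ih (w ++ [g.eval w])
    simp only [List.length_append, List.length_cons, List.length_nil] at this
    rw [List.length_cons]
    exact this.trans (by omega)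

/-- The evaluation of a list of gates into consecutive qubits from `t` on. -/
def computeCircuit (k : ℕ) : ℕ → List BGate → QCircuit
  | _, [] => []
  | t, g :: gs => gateCircuit k t g ++ computeCircuit k (t + 1) gs

/-- The inverse of the evaluation of a list of gates into consecutive qubits from `t` on. The list
is given in reverse order. -/
def uncomputeCircuit (k t : ℕ) : List BGate → QCircuit
  | [] => []
  | g :: gs => gateCircuit k (t + gs.length) g ++ uncomputeCircuit k t gs

lemma computeCircuit_classical (k : ℕ) {n : ℕ} {gs : List BGate} (h : GatesWF n gs) :
    (computeCircuit k (k + 1 + n) gs).Classical := by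
  induction gs generalizing n with
  | nil => simp [computeCircuit, QCircuit.Classical]
  | cons g gs ih => exact (gateCircuit_classical k h.cons.1).append (ih h.cons.2)

lemma uncomputeCircuit_classical (k : ℕ) {n : ℕ} {gs : List BGate} (h : GatesWF n gs.reverse) :
    (uncomputeCircuit k (k + 1 + n) gs).Classical := by
  induction gs with
  | nil => simp [uncomputeCircuit, QCircuit.Classical]
  | cons g gs ih =>
    rw [List.reverse_cons] at h
    have h2 := h.concat.2
    rw [List.length_reverse] at h2
    exact (by rw [add_assoc]; exact gateCircuit_classical k h2 :
      (gateCircuit k (k + 1 + n + gs.length) g).Classical).append (ih h.concat.1)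

lemma move_computeCircuit {d w : List Bool} {gs : List BGate} (h : GatesWF w.length gs) :
    QCircuit.move (computeCircuit d.length (d.length + 1 + w.length) gs) (ket d w) =
      ket d (evalGates w gs) := by
  induction gs generalizing w with
  | nil => rfl
  | cons g gs ih =>
    have h1 := move_gateCircuit (d := d) h.cons.1 false
    rw [ket_append_false, Bool.false_xor] at h1
    have h2 := ih (w := w ++ [g.eval w]) (by simpa using h.cons.2)
    rw [computeCircuit, QCircuit.move_append, h1]
    change _ = ket d (evalGates (w ++ [g.eval w]) gs)
    simpa [add_assoc] using h2

lemma move_uncomputeCircuit {d w : List Bool} {gs : List BGate} (h : GatesWF w.length gs.reverse) :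
    QCircuit.move (uncomputeCircuit d.length (d.length + 1 + w.length) gs)
      (ket d (evalGates w gs.reverse)) = ket d w := by
  induction gs with
  | nil => rfl
  | cons g gs ih =>
    rw [List.reverse_cons] at h ⊢
    have hl := length_evalGates w gs.reverse
    rw [List.length_reverse] at hl
    have h2 := h.concat.2
    rw [List.length_reverse, ← hl] at h2
    have h1 := move_gateCircuit (d := d) h2 (g.eval (evalGates w gs.reverse))
    rw [Bool.xor_self, ket_append_false, hl, ← add_assoc] at h1
    rw [uncomputeCircuit, QCircuit.move_append]
    have h3 : evalGates w (gs.reverse ++ [g]) =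
      evalGates w gs.reverse ++ [g.eval (evalGates w gs.reverse)] := List.foldl_append
    rw [h3, h1, ih h.concat.1]

/-- Add the wires in a list to consecutive data qubits from `i` on. -/
def outCircuit (k : ℕ) : ℕ → List ℕ → QCircuit
  | _, [] => []
  | i, o :: os => .CNOT (k + 1 + o) i :: outCircuit k (i + 1) os

lemma outCircuit_classical {k i : ℕ} {os : List ℕ} (h : i + os.length ≤ k) :
    (outCircuit k i os).Classical := by
  induction os generalizing i with
  | nil => simp [outCircuit, QCircuit.Classical]
  | cons o os ih =>
    rw [List.length_cons] at h
    intro g hg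
    rcases List.mem_cons.1 hg with rfl | hg
    · rw [Gate.Classical]; omega
    · exact ih (by omega) g hg

lemma move_outCircuit (w d : List Bool) {d' : List Bool} {os : List ℕ} (h : d'.length = os.length) :
    QCircuit.move (outCircuit (d ++ d').length d.length os) (ket (d ++ d') w) =
      ket (d ++ List.zipWith (fun b o => xor b (w.getD o false)) d' os) w := by
  induction os generalizing d d' with
  | nil => rw [List.length_eq_zero_iff.1 h]; rfl
  | cons o os ih =>
    obtain _ | ⟨b, d'⟩ := d'
    · simp at h
    have ih := ih (d ++ [xor b (w.getD o false)]) (d' := d') (by simpa using h)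
    rw [outCircuit, QCircuit.move_cons, Gate.move]
    simp only [mem_ket_wire]
    have : (if w.getD o false = true then Gate.flip d.length (ket (d ++ b :: d') w)
        else ket (d ++ b :: d') w) = ket (d ++ xor b (w.getD o false) :: d') w := by
      cases w.getD o false
      · simp
      · simp [flip_ket_data]
    rw [this]
    simpa only [List.append_assoc, List.singleton_append, List.length_append, List.length_cons,
      List.length_nil, zero_add, List.zipWith_cons_cons, add_assoc, add_comm,
      add_left_comm] using ih

/-- Add `C(e; z)` to the data register, where the wires hold `e` and `z`. -/
def RandCircuit.xorCircuit {k r : ℕ} (C : RandCircuit k r) : QCircuit :=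
  computeCircuit k (k + 1 + (k + r)) C.gates ++ (outCircuit k 0 (List.ofFn C.out) ++
    uncomputeCircuit k (k + 1 + (k + r)) C.gates.reverse)

lemma RandCircuit.xorCircuit_classical {k r : ℕ} (C : RandCircuit k r) :
    C.xorCircuit.Classical :=
  (computeCircuit_classical k C.gates_wf).append
    ((outCircuit_classical (by simp)).append
      (uncomputeCircuit_classical k (by rw [List.reverse_reverse]; exact C.gates_wf)))

lemma zipWith_ofFn {α β γ : Type*} {n : ℕ} (f : α → β → γ) (a : Fin n → α) (b : Fin n → β) :
    List.zipWith f (List.ofFn a) (List.ofFn b) = List.ofFn fun i => f (a i) (b i) := by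
  apply List.ext_getElem <;> simp

lemma RandCircuit.move_xorCircuit {k r : ℕ} (C : RandCircuit k r) (d e : Fin k → Bool)
    (z : Fin r → Bool) :
    C.xorCircuit.move (ket (List.ofFn d) (List.ofFn e ++ List.ofFn z)) =
      ket (List.ofFn fun i => xor (d i) (C.eval e z i)) (List.ofFn e ++ List.ofFn z) := by
  have hw : (List.ofFn e ++ List.ofFn z).length = k + r := by simp
  have hwf : GatesWF (List.ofFn e ++ List.ofFn z).length C.gates := by rw [hw]; exact C.gates_wf
  have h1 := move_computeCircuit (d := List.ofFn d) hwf
  have h2 := move_outCircuit (evalGates (List.ofFn e ++ List.ofFn z) C.gates) []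
    (d' := List.ofFn d) (os := List.ofFn C.out) (by simp)
  have h3 := move_uncomputeCircuit (d := List.ofFn fun i => xor (d i) (C.eval e z i))
    (w := List.ofFn e ++ List.ofFn z) (gs := C.gates.reverse)
    (by rw [List.reverse_reverse]; exact hwf)
  rw [List.reverse_reverse] at h3
  rw [zipWith_ofFn] at h2
  simp only [List.nil_append, List.length_nil, List.length_ofFn, hw] at h1 h2 h3
  rw [xorCircuit, QCircuit.move_append, QCircuit.move_append, h1, h2]
  exact h3

/-- Exchange the data register with the first wires. -/
def swapCircuit (k j : ℕ) : QCircuit := (List.range j).map fun i => .SWAP i (k + 1 + i)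

lemma swapCircuit_succ (k j : ℕ) :
    swapCircuit k (j + 1) = swapCircuit k j ++ [.SWAP j (k + 1 + j)] := by
  simp [swapCircuit, List.range_succ]

lemma swapCircuit_classical (k j : ℕ) : (swapCircuit k j).Classical := by
  intro g hg
  obtain ⟨i, -, rfl⟩ := List.mem_map.1 hg
  rw [Gate.Classical]; omega

lemma mem_move_swapCircuit {k j a : ℕ} (hj : j ≤ k) (s : Ket) :
    a ∈ (swapCircuit k j).move s ↔
      (if a < j then k + 1 + a else if k + 1 ≤ a ∧ a < k + 1 + j then a - (k + 1) else a) ∈ s := by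
  induction j generalizing a with
  | zero =>
    rw [if_neg (by omega), if_neg (by omega)]; rfl
  | succ j ih =>
    rw [swapCircuit_succ, QCircuit.move_append, QCircuit.move_cons, Gate.move]
    change a ∈ Finset.image _ _ ↔ _
    rw [mem_image_swap, ih (by omega), Equiv.swap_apply_def]
    have : ∀ x y : ℕ, x = y → (x ∈ s ↔ y ∈ s) := fun x y h => by rw [h]
    apply this
    split_ifs <;> omega

lemma move_swapCircuit {k r : ℕ} (d e : Fin k → Bool) (z : Fin r → Bool) :
    (swapCircuit k k).move (ket (List.ofFn d) (List.ofFn e ++ List.ofFn z)) =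
      ket (List.ofFn e) (List.ofFn d ++ List.ofFn z) := by
  have hl : ∀ (x : Fin k → Bool) (a : ℕ), a < k → (List.ofFn x ++ List.ofFn z).getD a false =
      (List.ofFn x).getD a false := fun x a h => List.getD_append _ _ _ _ (by simpa using h)
  have hr : ∀ (x : Fin k → Bool) (a : ℕ), k ≤ a → (List.ofFn x ++ List.ofFn z).getD a false =
      (List.ofFn z).getD (a - k) false := fun x a h => by
    rw [List.getD_append_right _ _ _ _ (by simpa using h), List.length_ofFn]
  ext a
  rw [mem_move_swapCircuit le_rfl]
  split_ifs with h1 h2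
  · have := mem_ket_wire (d := List.ofFn d) (w := List.ofFn e ++ List.ofFn z) (i := a)
    rw [List.length_ofFn] at this
    rw [this, mem_ket, layout, List.length_ofFn, if_pos h1, hl _ _ h1]
  · rw [mem_ket, mem_ket, layout, layout, List.length_ofFn, List.length_ofFn, if_neg h1,
      if_pos (show a - (k + 1) < k by omega), if_neg (show a ≠ k by omega), hl _ _ (by omega)]
  · rw [mem_ket, mem_ket, layout, layout, List.length_ofFn, List.length_ofFn, if_neg h1, if_neg h1]
    split_ifs
    · rfl
    · rw [hr _ _ (by omega), hr _ _ (by omega)]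

/-- Replace the data `x` by `C_→(x; z)`: the backward circuit erases the old data. -/
def InvPair.circuit {k : ℕ} (p : InvPair k) : QCircuit :=
  swapCircuit k k ++ (p.fwd.xorCircuit ++ (swapCircuit k k ++
    (p.bwd.xorCircuit ++ swapCircuit k k)))

lemma InvPair.circuit_classical {k : ℕ} (p : InvPair k) : p.circuit.Classical :=
  (swapCircuit_classical k k).append (p.fwd.xorCircuit_classical.append
    ((swapCircuit_classical k k).append (p.bwd.xorCircuit_classical.append
      (swapCircuit_classical k k))))

lemma InvPair.move_circuit {k : ℕ} (p : InvPair k) (x : Fin k → Bool) (z : Fin p.r → Bool) :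
    p.circuit.move (ket (List.ofFn x) (List.ofFn (fun _ : Fin k => false) ++ List.ofFn z)) =
      ket (List.ofFn (p.fwd.eval x z))
        (List.ofFn (fun _ : Fin k => false) ++ List.ofFn z) := by
  rw [circuit, QCircuit.move_append, QCircuit.move_append, QCircuit.move_append,
    QCircuit.move_append, move_swapCircuit, p.fwd.move_xorCircuit, move_swapCircuit,
    p.bwd.move_xorCircuit, move_swapCircuit]
  simp only [Bool.false_xor, p.inv z x, Bool.xor_self]

/-! ### The memory of the program -/

/-- The memory that begins with a list and is `0` beyond it. -/
def memOf (L : List ℕ) (n : ℕ) : ℕ := L.getD n 0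

lemma update_memOf {L : List ℕ} {i x : ℕ} (h : i < L.length) :
    Function.update (memOf L) i x = memOf (L.set i x) := by
  funext n
  by_cases hn : n = i
  · subst hn
    simp [memOf, h]
  · rw [Function.update_of_ne hn, memOf, memOf, List.getD_eq_getElem?_getD,
      List.getD_eq_getElem?_getD, List.getElem?_set_ne (Ne.symm hn)]

/-- The variables of the program, which occupy cells `3, …, 17` in this order: four times `δ`, the
number of bits, the number of remaining pairs, the position in the input, the number of random bits,
the increment of `λ` and `λ` itself, the number of gates, the qubit of the current gate, a loop
counter, two pointers to qubits, and the current gate. -/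
structure Vars where
  d : ℕ := 0
  k : ℕ := 0
  l : ℕ := 0
  p : ℕ := 0
  r : ℕ := 0
  inc : ℕ := 0
  lam : ℕ := 0
  G : ℕ := 0
  w : ℕ := 0
  c : ℕ := 0
  q : ℕ := 0
  o : ℕ := 0
  op : ℕ := 0
  i : ℕ := 0
  j : ℕ := 0

namespace Vars

/-- The memory for given values of the variables. The cells `0, 1, 2, 18, 19` hold the output bit
`1` and the constants `0`, `1`, `k + 1`, `3`. -/
def toMem (v : Vars) : ℕ → ℕ :=
  memOf [1, 0, 1, v.d, v.k, v.l, v.p, v.r, v.inc, v.lam, v.G, v.w, v.c, v.q, v.o, v.op, v.i, v.j,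
    v.k + 1, 3]

variable (v : Vars) (x : ℕ)

@[simp] lemma toMem_zero : v.toMem 1 = 0 := rfl
@[simp] lemma toMem_one : v.toMem 2 = 1 := rfl
@[simp] lemma toMem_d : v.toMem 3 = v.d := rfl
@[simp] lemma toMem_k : v.toMem 4 = v.k := rfl
@[simp] lemma toMem_l : v.toMem 5 = v.l := rfl
@[simp] lemma toMem_p : v.toMem 6 = v.p := rfl
@[simp] lemma toMem_r : v.toMem 7 = v.r := rfl
@[simp] lemma toMem_inc : v.toMem 8 = v.inc := rfl
@[simp] lemma toMem_lam : v.toMem 9 = v.lam := rfl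
@[simp] lemma toMem_G : v.toMem 10 = v.G := rfl
@[simp] lemma toMem_w : v.toMem 11 = v.w := rfl
@[simp] lemma toMem_c : v.toMem 12 = v.c := rfl
@[simp] lemma toMem_q : v.toMem 13 = v.q := rfl
@[simp] lemma toMem_o : v.toMem 14 = v.o := rfl
@[simp] lemma toMem_op : v.toMem 15 = v.op := rfl
@[simp] lemma toMem_i : v.toMem 16 = v.i := rfl
@[simp] lemma toMem_j : v.toMem 17 = v.j := rfl
@[simp] lemma toMem_base : v.toMem 18 = v.k + 1 := rfl
@[simp] lemma toMem_three : v.toMem 19 = 3 := rfl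

@[simp] lemma update_result : Function.update v.toMem 0 1 = v.toMem := update_memOf (by simp)
@[simp] lemma update_l : Function.update v.toMem 5 x = { v with l := x }.toMem :=
  update_memOf (by simp)
@[simp] lemma update_p : Function.update v.toMem 6 x = { v with p := x }.toMem :=
  update_memOf (by simp)
@[simp] lemma update_r : Function.update v.toMem 7 x = { v with r := x }.toMem :=
  update_memOf (by simp)
@[simp] lemma update_inc : Function.update v.toMem 8 x = { v with inc := x }.toMem :=
  update_memOf (by simp)
@[simp] lemma update_lam : Function.update v.toMem 9 x = { v with lam := x }.toMem :=
  update_memOf (by simp)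
@[simp] lemma update_G : Function.update v.toMem 10 x = { v with G := x }.toMem :=
  update_memOf (by simp)
@[simp] lemma update_w : Function.update v.toMem 11 x = { v with w := x }.toMem :=
  update_memOf (by simp)
@[simp] lemma update_c : Function.update v.toMem 12 x = { v with c := x }.toMem :=
  update_memOf (by simp)
@[simp] lemma update_q : Function.update v.toMem 13 x = { v with q := x }.toMem :=
  update_memOf (by simp)
@[simp] lemma update_o : Function.update v.toMem 14 x = { v with o := x }.toMem :=
  update_memOf (by simp)
@[simp] lemma update_op : Function.update v.toMem 15 x = { v with op := x }.toMem :=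
  update_memOf (by simp)
@[simp] lemma update_i : Function.update v.toMem 16 x = { v with i := x }.toMem :=
  update_memOf (by simp)
@[simp] lemma update_j : Function.update v.toMem 17 x = { v with j := x }.toMem :=
  update_memOf (by simp)

end Vars

/-- The data for given values of the variables and an empty query tape. -/
def st (v : Vars) (ψ : QVec) : St := ⟨v.toMem, [], ∅, ψ⟩

/-! ### The program for reversible evaluation -/

/-- Apply the gate circuit of the gate at the current position of the input to qubit `w`. -/
def gateCmd : Cmd :=
  .seq (.block [.read 15 6, .add 14 6 2, .read 16 14, .add 14 14 2, .read 17 14, .add 16 18 16,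
    .add 17 18 17])
  (.seq (.ite 15 (.block [.gate (.CNOT 16 11), .gate (.X 11)])
    (.seq (.block [.sub 15 15 2])
    (.seq (.ite 15 (.block []) (.block [.gate (.CNOT 16 11), .gate (.CNOT 17 11)]))
      (.block [.gate (.CNOT 17 4), .gate (.Tof 16 4 11), .gate (.CNOT 17 4)]))))
  (.block [.const 14 0, .const 15 0, .const 16 0, .const 17 0]))

section RAM

variable {input : List ℕ} {ψ : QVec}

lemma runs_gateCmd (v : Vars) (g : BGate) (hg : SitsAt input v.p g.encode)
    (ho : v.o = 0) (hop : v.op = 0) (hi : v.i = 0) (hj : v.j = 0) :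
    Runs input gateCmd (st v ψ) (st v ((gateCircuit v.k v.w g).apply ψ)) 30 0 := by
  obtain ⟨d, k, l, p, r, inc, lam, G, w, c, q, o, op, i, j⟩ := v
  dsimp only at hg ho hop hi hj ⊢
  subst ho hop hi hj
  -- the gate is decoded as `n a b`
  obtain ⟨n, a, b, he⟩ : ∃ n a b, g.encode = [n, a, b] := by
    cases g <;> exact ⟨_, _, _, rfl⟩
  rw [he] at hg
  have h0 := hg.getD_head 0
  have h1 := hg.tail.getD_head 0
  have h2 := hg.tail.tail.getD_head 0
  have A : Runs input (.block [.read 15 6, .add 14 6 2, .read 16 14, .add 14 14 2, .read 17 14,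
      .add 16 18 16, .add 17 18 17]) (st ⟨d, k, l, p, r, inc, lam, G, w, c, q, 0, 0, 0, 0⟩ ψ)
      (st ⟨d, k, l, p, r, inc, lam, G, w, c, q, p + 1 + 1, n, k + 1 + a, k + 1 + b⟩ ψ) 7 0 := by
    refine Runs.block (by simp [Instr.Simple]) ?_
    simp [Instr.effect, st, h0, h1, h2, -List.getD_eq_getElem?_getD]
  have Z : ∀ (o op i j : ℕ) (φ : QVec), Runs input (.block [.const 14 0, .const 15 0, .const 16 0,
      .const 17 0]) (st ⟨d, k, l, p, r, inc, lam, G, w, c, q, o, op, i, j⟩ φ)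
      (st ⟨d, k, l, p, r, inc, lam, G, w, c, q, 0, 0, 0, 0⟩ φ) 4 0 := fun o op i j φ => by
    refine Runs.block (by simp [Instr.Simple]) ?_
    simp [Instr.effect, st]
  have S : ∀ m φ, Runs input (.block [.sub 15 15 2])
      (st ⟨d, k, l, p, r, inc, lam, G, w, c, q, p + 1 + 1, m + 1, k + 1 + a, k + 1 + b⟩ φ)
      (st ⟨d, k, l, p, r, inc, lam, G, w, c, q, p + 1 + 1, m, k + 1 + a, k + 1 + b⟩ φ) 1 0 :=
    fun m φ => by
      refine Runs.block (by simp [Instr.Simple]) ?_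
      simp [Instr.effect, st]
  have T : ∀ m φ, Runs input (.block [.gate (.CNOT 17 4), .gate (.Tof 16 4 11), .gate (.CNOT 17 4)])
      (st ⟨d, k, l, p, r, inc, lam, G, w, c, q, p + 1 + 1, m, k + 1 + a, k + 1 + b⟩ φ)
      (st ⟨d, k, l, p, r, inc, lam, G, w, c, q, p + 1 + 1, m, k + 1 + a, k + 1 + b⟩
        (QCircuit.apply [.CNOT (k + 1 + b) k, .Tof (k + 1 + a) k w, .CNOT (k + 1 + b) k] φ)) 3 0 :=
    fun m φ => by
      refine Runs.block (by simp [Instr.Simple]) ?_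
      simp [Instr.effect, st, Gate.map, QCircuit.apply]
  rcases g with x | ⟨x, y⟩ | ⟨x, y⟩ <;>
    simp only [BGate.encode, List.cons.injEq, and_true] at he <;>
    obtain ⟨rfl, rfl, rfl⟩ := he
  · have M := Runs.block (input := input) (L := [.gate (.CNOT 16 11), .gate (.X 11)])
      (S := st ⟨d, k, l, p, r, inc, lam, G, w, c, q, p + 1 + 1, 0, k + 1 + x, k + 1 + 0⟩ ψ)
      (by simp [Instr.Simple]) rfl
    refine (A.seq ((Runs.ite_zero rfl M).seq (Z (p + 1 + 1) 0 (k + 1 + x) (k + 1 + 0) _))).mono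
      (by simp) (by simp)
  · have M := Runs.ite_zero (a := 15) (s₂ := .block [.gate (.CNOT 16 11), .gate (.CNOT 17 11)])
      (S := st ⟨d, k, l, p, r, inc, lam, G, w, c, q, p + 1 + 1, 0, k + 1 + x, k + 1 + y⟩ ψ) rfl
      (Runs.block (input := input) (L := []) (by simp) rfl)
    refine (A.seq ((Runs.ite_pos (by simp [st]) rfl ((S 0 ψ).seq
      (M.seq (T 0 ψ)))).seq (Z _ _ _ _ _))).mono (by simp) (by simp)
  · have M := Runs.ite_pos (a := 15) (s₁ := .block [])
      (S := st ⟨d, k, l, p, r, inc, lam, G, w, c, q, p + 1 + 1, 1, k + 1 + x, k + 1 + y⟩ ψ)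
      (S' := st ⟨d, k, l, p, r, inc, lam, G, w, c, q, p + 1 + 1, 1, k + 1 + x, k + 1 + y⟩
        (QCircuit.apply [.CNOT (k + 1 + x) w, .CNOT (k + 1 + y) w] ψ)) (by simp [st]) rfl
      (Runs.block (input := input) (L := [.gate (.CNOT 16 11), .gate (.CNOT 17 11)])
        (by simp [Instr.Simple]) rfl)
    have F := A.seq ((Runs.ite_pos (a := 15) (s₁ := .block [.gate (.CNOT 16 11), .gate (.X 11)])
      (by simp [st]) rfl ((S 1 ψ).seq (M.seq (T 1 _)))).seq (Z _ _ _ _ _))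
    exact F.mono (by simp) (by simp)

/-- Evaluate `c` gates. -/
def computeLoop : Cmd :=
  .loop 12 (.seq gateCmd (.block [.add 6 6 19, .add 11 11 2, .sub 12 12 2]))

lemma BGate.length_encode (g : BGate) : g.encode.length = 3 := by cases g <;> rfl

lemma length_flatMap_encode (gs : List BGate) :
    (gs.flatMap BGate.encode).length = 3 * gs.length := by
  induction gs with
  | nil => rfl
  | cons g gs ih =>
    rw [List.flatMap_cons, List.length_append, ih, BGate.length_encode, List.length_cons]; ring

lemma runs_computeLoop (gs : List BGate) (v : Vars) (hc : v.c = gs.length)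
    (hg : SitsAt input v.p (gs.flatMap BGate.encode))
    (ho : v.o = 0) (hop : v.op = 0) (hi : v.i = 0) (hj : v.j = 0) :
    Runs input computeLoop (st v ψ)
      (st { v with c := 0, p := v.p + 3 * gs.length, w := v.w + gs.length }
        ((computeCircuit v.k v.w gs).apply ψ)) (gs.length * 35 + 1) 0 := by
  induction gs generalizing v ψ with
  | nil =>
    have : ({ v with c := 0, p := v.p + 3 * 0, w := v.w + 0 } : Vars) = v := by
      cases v; simp at hc; simp [hc]
    rw [List.length_nil, this]
    exact Runs.while_zero hc
  | cons g gs ih =>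
    rw [List.flatMap_cons] at hg
    have hr := hg.right
    rw [BGate.length_encode] at hr
    have h1 := runs_gateCmd (ψ := ψ) v g hg.left ho hop hi hj
    have h2 : Runs input (.block [.add 6 6 19, .add 11 11 2, .sub 12 12 2])
        (st v ((gateCircuit v.k v.w g).apply ψ))
        (st { v with p := v.p + 3, w := v.w + 1, c := gs.length }
          ((gateCircuit v.k v.w g).apply ψ)) 3 0 := by
      refine Runs.block (by simp [Instr.Simple]) ?_
      simp [Instr.effect, st, hc]
    have h3 := ih (ψ := (gateCircuit v.k v.w g).apply ψ)
      { v with p := v.p + 3, w := v.w + 1, c := gs.length } rfl hr ho hop hi hj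
    have h4 := Runs.while_succ (a := 12) (by simp [st, hc]) rfl (h1.seq h2) h3
    rw [computeCircuit, QCircuit.apply_append, List.length_cons]
    have e :
        ({ v with c := 0, p := v.p + 3 * (gs.length + 1), w := v.w + (gs.length + 1) } : Vars) =
        { v with c := 0, p := v.p + 3 + 3 * gs.length, w := v.w + 1 + gs.length } := by
      congr 1 <;> ring
    rw [e]
    exact h4.mono (by ring_nf; omega) (by simp)

/-- Undo the evaluation of `c` gates, whose descriptions end at the current position. -/
def uncomputeLoop : Cmd :=
  .loop 12 (.seq (.block [.sub 6 6 19, .sub 11 11 2]) (.seq gateCmd (.block [.sub 12 12 2])))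

lemma runs_uncomputeLoop (gs : List BGate) (p w : ℕ) (v : Vars) (hc : v.c = gs.length)
    (hp : v.p = p + 3 * gs.length) (hw : v.w = w + gs.length)
    (hg : SitsAt input p (gs.reverse.flatMap BGate.encode))
    (ho : v.o = 0) (hop : v.op = 0) (hi : v.i = 0) (hj : v.j = 0) :
    Runs input uncomputeLoop (st v ψ) (st { v with c := 0, p := p, w := w }
        ((uncomputeCircuit v.k w gs).apply ψ)) (gs.length * 38 + 1) 0 := by
  induction gs generalizing v ψ with
  | nil =>
    have : ({ v with c := 0, p := p, w := w } : Vars) = v := by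
      cases v; simp at hc hp hw; simp [hc, hp, hw]
    rw [List.length_nil, this]
    exact Runs.while_zero hc
  | cons g gs ih =>
    rw [List.reverse_cons, List.flatMap_append] at hg
    have hr := hg.right
    rw [length_flatMap_encode, List.length_reverse] at hr
    rw [List.length_cons] at hc hp hw
    have h0 : Runs input (.block [.sub 6 6 19, .sub 11 11 2]) (st v ψ)
        (st { v with p := p + 3 * gs.length, w := w + gs.length } ψ) 2 0 := by
      refine Runs.block (by simp [Instr.Simple]) ?_
      simp only [Instr.effect, st, hp, hw, List.foldl_cons, List.foldl_nil, Vars.toMem_p,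
        Vars.toMem_three, Vars.update_p, Vars.toMem_w, Vars.toMem_one, Vars.update_w]
      congr 3
    have h1 := runs_gateCmd (input := input) (ψ := ψ)
      { v with p := p + 3 * gs.length, w := w + gs.length } g
      (by simpa using hr) ho hop hi hj
    have h2 : Runs input (.block [.sub 12 12 2])
        (st { v with p := p + 3 * gs.length, w := w + gs.length }
          ((gateCircuit v.k (w + gs.length) g).apply ψ))
        (st { v with p := p + 3 * gs.length, w := w + gs.length, c := gs.length }
          ((gateCircuit v.k (w + gs.length) g).apply ψ)) 1 0 := by
      refine Runs.block (by simp [Instr.Simple]) ?_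
      simp [Instr.effect, st, hc]
    have h3 := ih (ψ := (gateCircuit v.k (w + gs.length) g).apply ψ)
      { v with p := p + 3 * gs.length, w := w + gs.length, c := gs.length } rfl rfl rfl hg.left
      ho hop hi hj
    have h4 := Runs.while_succ (a := 12) (by simp [st, hc]) rfl (h0.seq (h1.seq h2)) h3
    rw [uncomputeCircuit, QCircuit.apply_append, List.length_cons]
    exact h4.mono (by ring_nf; omega) (by simp)

/-- Add `c` output wires to the data qubits from `q` on. -/
def outLoop : Cmd :=
  .loop 12 (.block [.read 16 6, .add 16 18 16, .gate (.CNOT 16 13), .const 16 0, .add 6 6 2,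
    .add 13 13 2, .sub 12 12 2])

lemma runs_outLoop (os : List ℕ) (v : Vars) (hc : v.c = os.length) (hg : SitsAt input v.p os)
    (hi : v.i = 0) :
    Runs input outLoop (st v ψ)
      (st { v with c := 0, p := v.p + os.length, q := v.q + os.length }
        ((outCircuit v.k v.q os).apply ψ)) (os.length * 9 + 1) 0 := by
  induction os generalizing v ψ with
  | nil =>
    have : ({ v with c := 0, p := v.p + 0, q := v.q + 0 } : Vars) = v := by
      cases v; simp at hc; simp [hc]
    rw [List.length_nil, this]
    exact Runs.while_zero hc
  | cons o os ih =>
    have h2 : Runs input (.block [.read 16 6, .add 16 18 16, .gate (.CNOT 16 13), .const 16 0,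
        .add 6 6 2, .add 13 13 2, .sub 12 12 2]) (st v ψ)
        (st { v with p := v.p + 1, q := v.q + 1, c := os.length }
          ((Gate.CNOT (v.k + 1 + o) v.q).apply ψ)) 7 0 := by
      refine Runs.block (by simp [Instr.Simple]) ?_
      simp [Instr.effect, st, hc, hi, hg.getD_head, Gate.map, -List.getD_eq_getElem?_getD]
    have h3 := ih (ψ := (Gate.CNOT (v.k + 1 + o) v.q).apply ψ)
      { v with p := v.p + 1, q := v.q + 1, c := os.length } rfl hg.tail hi
    have h4 := Runs.while_succ (a := 12) (by simp [st, hc]) rfl h2 h3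
    rw [outCircuit, List.length_cons]
    have e : ({ v with c := 0, p := v.p + (os.length + 1), q := v.q + (os.length + 1) } : Vars) =
        { v with c := 0, p := v.p + 1 + os.length, q := v.q + 1 + os.length } := by
      congr 1 <;> ring
    rw [e]
    exact h4.mono (by ring_nf; omega) (by simp)

/-- Add the output of the circuit at the current position of the input to the data register. -/
def circuitCmd : Cmd :=
  .seq (.block [.read 10 6, .add 6 6 2, .add 11 4 7, .add 11 18 11, .add 12 10 1])
  (.seq computeLoop
  (.seq (.block [.const 13 0, .add 12 4 1])
  (.seq outLoop
  (.seq (.block [.const 13 0, .sub 6 6 4, .add 12 10 1])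
  (.seq uncomputeLoop
  (.block [.add 6 6 10, .add 6 6 10, .add 6 6 10, .add 6 6 4, .const 10 0, .const 11 0]))))))

lemma RandCircuit.length_encode {k r : ℕ} (C : RandCircuit k r) :
    C.encode.length = 1 + 3 * C.gates.length + k := by
  rw [RandCircuit.encode, List.length_cons, List.length_append, length_flatMap_encode,
    List.length_ofFn]; ring

lemma runs_circuitCmd {d k l p r inc lam q : ℕ} (C : RandCircuit k r)
    (hg : SitsAt input p C.encode) :
    Runs input circuitCmd
      (st { d := d, k := k, l := l, p := p, r := r, inc := inc, lam := lam, q := q } ψ)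
      (st { d := d, k := k, l := l, p := p + C.encode.length, r := r, inc := inc, lam := lam }
        (C.xorCircuit.apply ψ)) (40 * C.encode.length) 0 := by
  rw [RandCircuit.encode] at hg
  have hl := C.length_encode
  have g0 := hg.getD_head 0
  have g1 := hg.tail.left
  have g2 := hg.tail.right
  rw [length_flatMap_encode] at g2
  rw [RandCircuit.xorCircuit, QCircuit.apply_append, QCircuit.apply_append]
  set n := C.gates.length with hn
  have h1 : Runs input (.block [.read 10 6, .add 6 6 2, .add 11 4 7, .add 11 18 11, .add 12 10 1])
      (st { d := d, k := k, l := l, p := p, r := r, inc := inc, lam := lam, q := q } ψ)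
      (st { d := d, k := k, l := l, p := p + 1, r := r, inc := inc, lam := lam, q := q, G := n,
            w := k + 1 + (k + r), c := n } ψ) 5 0 := by
    refine Runs.block (by simp [Instr.Simple]) ?_
    simp [Instr.effect, st, g0, -List.getD_eq_getElem?_getD]
  have h2 := runs_computeLoop (ψ := ψ) C.gates
    { d := d, k := k, l := l, p := p + 1, r := r, inc := inc, lam := lam, q := q, G := n,
      w := k + 1 + (k + r), c := n } rfl g1 rfl rfl rfl rfl
  dsimp only at h2
  set ψ₁ := (computeCircuit k (k + 1 + (k + r)) C.gates).apply ψ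
  rw [← hn] at h2
  have h3 : Runs input (.block [.const 13 0, .add 12 4 1])
      (st { d := d, k := k, l := l, p := p + 1 + 3 * n, r := r, inc := inc, lam := lam, q := q,
            G := n, w := k + 1 + (k + r) + n, c := 0 } ψ₁)
      (st { d := d, k := k, l := l, p := p + 1 + 3 * n, r := r, inc := inc, lam := lam, q := 0,
            G := n, w := k + 1 + (k + r) + n, c := k } ψ₁) 2 0 := by
    refine Runs.block (by simp [Instr.Simple]) ?_
    simp [Instr.effect, st]
  have h4 := runs_outLoop (ψ := ψ₁) (List.ofFn C.out)
    { d := d, k := k, l := l, p := p + 1 + 3 * n, r := r, inc := inc, lam := lam, q := 0,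
      G := n, w := k + 1 + (k + r) + n, c := k } (by simp) g2 rfl
  dsimp only at h4
  set ψ₂ := (outCircuit k 0 (List.ofFn C.out)).apply ψ₁
  rw [List.length_ofFn] at h4
  have h5 : Runs input (.block [.const 13 0, .sub 6 6 4, .add 12 10 1])
      (st { d := d, k := k, l := l, p := p + 1 + 3 * n + k, r := r, inc := inc, lam := lam,
            q := 0 + k, G := n, w := k + 1 + (k + r) + n, c := 0 } ψ₂)
      (st { d := d, k := k, l := l, p := p + 1 + 3 * n, r := r, inc := inc, lam := lam, q := 0,
            G := n, w := k + 1 + (k + r) + n, c := n } ψ₂) 3 0 := by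
    refine Runs.block (by simp [Instr.Simple]) ?_
    simp [Instr.effect, st]
  have h6 := runs_uncomputeLoop (input := input) (ψ := ψ₂) C.gates.reverse (p + 1)
    (k + 1 + (k + r))
    { d := d, k := k, l := l, p := p + 1 + 3 * n, r := r, inc := inc, lam := lam, q := 0,
      G := n, w := k + 1 + (k + r) + n, c := n } (by simp [hn]) (by simp [hn]) (by simp [hn])
    (by simpa using g1) rfl rfl rfl rfl
  dsimp only at h6
  set ψ₃ := (uncomputeCircuit k (k + 1 + (k + r)) C.gates.reverse).apply ψ₂
  rw [List.length_reverse, ← hn] at h6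
  have h7 : Runs input (.block [.add 6 6 10, .add 6 6 10, .add 6 6 10, .add 6 6 4, .const 10 0,
      .const 11 0])
      (st { d := d, k := k, l := l, p := p + 1, r := r, inc := inc, lam := lam, q := 0,
            G := n, w := k + 1 + (k + r), c := 0 } ψ₃)
      (st { d := d, k := k, l := l, p := p + C.encode.length, r := r, inc := inc, lam := lam }
        ψ₃) 6 0 := by
    refine Runs.block (by simp [Instr.Simple]) ?_
    rw [hl]
    simp only [Instr.effect, st, List.foldl_cons, List.foldl_nil, Vars.toMem_p, Vars.toMem_G,
      Vars.toMem_k, Vars.update_p, Vars.update_G, Vars.update_w]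
    congr 3
    omega
  exact (h1.seq (h2.seq (h3.seq (h4.seq (h5.seq (h6.seq h7)))))).mono (by rw [hl]; omega) (by simp)

/-- Exchange the data register with the first wires. -/
def swapCmd : Cmd :=
  .seq (.block [.const 13 0, .add 14 18 1, .add 12 4 1])
  (.seq (.loop 12 (.block [.gate (.SWAP 13 14), .add 13 13 2, .add 14 14 2, .sub 12 12 2]))
  (.block [.const 13 0, .const 14 0]))

lemma runs_swapCmd {d k l p r inc lam q : ℕ} :
    Runs input swapCmd
      (st { d := d, k := k, l := l, p := p, r := r, inc := inc, lam := lam, q := q } ψ)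
      (st { d := d, k := k, l := l, p := p, r := r, inc := inc, lam := lam }
        ((swapCircuit k k).apply ψ)) (6 * k + 6) 0 := by
  have h1 : Runs input (.block [.const 13 0, .add 14 18 1, .add 12 4 1])
      (st { d := d, k := k, l := l, p := p, r := r, inc := inc, lam := lam, q := q } ψ)
      (st { d := d, k := k, l := l, p := p, r := r, inc := inc, lam := lam,
            c := k, q := 0, o := k + 1 } ψ) 3 0 := by
    refine Runs.block (by simp [Instr.Simple]) ?_
    simp [Instr.effect, st]
  have h2 := Runs.for_loop (input := input) (a := 12)
    (s := .block [.gate (.SWAP 13 14), .add 13 13 2, .add 14 14 2, .sub 12 12 2]) k 4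
    (fun j => st { d := d, k := k, l := l, p := p, r := r, inc := inc, lam := lam,
                   c := k - j, q := j, o := k + 1 + j } ((swapCircuit k j).apply ψ))
    (fun _ => 0) (fun j hj => by simp [st]) (fun j hj => rfl) (fun j hj => by
      refine Runs.block (by simp [Instr.Simple]) ?_
      rw [swapCircuit_succ, QCircuit.apply_append]
      simp [Instr.effect, st, Gate.map, QCircuit.apply, Nat.sub_sub, add_assoc])
  have h3 : Runs input (.block [.const 13 0, .const 14 0])
      (st { d := d, k := k, l := l, p := p, r := r, inc := inc, lam := lam,
            c := k - k, q := k, o := k + 1 + k } ((swapCircuit k k).apply ψ))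
      (st { d := d, k := k, l := l, p := p, r := r, inc := inc, lam := lam }
        ((swapCircuit k k).apply ψ)) 2 0 := by
    refine Runs.block (by simp [Instr.Simple]) ?_
    simp [Instr.effect, st]
  exact (h1.seq (h2.seq h3)).mono (by simp; omega) (by simp)

end RAM

/-! ### One pair of circuits -/

/-- All bit strings of length `r`. -/
def bitStrings (r : ℕ) : Multiset (List Bool) :=
  (Finset.univ : Finset (Fin r → Bool)).val.map List.ofFn

lemma mem_bitStrings {r : ℕ} {z : List Bool} : z ∈ bitStrings r ↔ z.length = r := by
  simp only [bitStrings, Multiset.mem_map, Finset.mem_val, Finset.mem_univ, true_and]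
  constructor
  · rintro ⟨f, rfl⟩; simp
  · rintro rfl; exact ⟨z.get, List.ofFn_get z⟩

lemma bitStrings_zero : bitStrings 0 = {[]} := rfl

lemma bitStrings_succ (r : ℕ) :
    bitStrings (r + 1) =
      (bitStrings r).map (· ++ [false]) + (bitStrings r).map (· ++ [true]) := by
  have hn : ∀ r, (bitStrings r).Nodup := fun r =>
    Multiset.Nodup.map List.ofFn_injective (Finset.nodup _)
  rw [Multiset.Nodup.ext (hn _)]
  · intro z
    rw [mem_bitStrings, Multiset.mem_add, Multiset.mem_map, Multiset.mem_map]
    simp only [mem_bitStrings]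
    constructor
    · intro hz
      rcases List.eq_nil_or_concat z with rfl | ⟨u, b, rfl⟩
      · simp at hz
      · have : u.length = r := by simpa using hz
        cases b
        · exact Or.inl ⟨u, this, by simp⟩
        · exact Or.inr ⟨u, this, by simp⟩
    · rintro (⟨u, hu, rfl⟩ | ⟨u, hu, rfl⟩) <;> simp [hu]
  · refine (Multiset.Nodup.add_iff ?_ ?_).2 ?_
    · exact (hn r).map fun a b h => by simpa using h
    · exact (hn r).map fun a b h => by simpa using h
    · rw [Multiset.disjoint_left]
      intro z hz hz'
      obtain ⟨u, -, rfl⟩ := Multiset.mem_map.1 hz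
      obtain ⟨u', -, h⟩ := Multiset.mem_map.1 hz'
      have := congrArg List.getLast? h
      simp at this

section Pair

variable {k : ℕ}

/-- The basis state that holds `x` in the data register. -/
def dataKet (x : Fin k → Bool) : Ket := ket (List.ofFn x) []

/-- The basis states that hold data from `X` and, on the wires behind the input wires, random bits
from `Z`. -/
def randKets (X : Multiset (Fin k → Bool)) (Z : Multiset (List Bool)) : Multiset Ket :=
  (X ×ˢ Z).map fun xz => ket (List.ofFn xz.1) (List.ofFn (fun _ : Fin k => false) ++ xz.2)

lemma randKets_zero (X : Multiset (Fin k → Bool)) :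
    randKets X (bitStrings 0) = X.map dataKet := by
  have : X ×ˢ ({[]} : Multiset (List Bool)) = X.map fun x => (x, []) := by
    simp [SProd.sprod, Multiset.product, Multiset.bind_singleton]
  rw [randKets, bitStrings_zero, this, Multiset.map_map]
  refine Multiset.map_congr rfl fun x _ => ?_
  simp only [Function.comp_apply, List.append_nil, List.ofFn_const, ket_replicate_false, dataKet]

lemma H_uniform_randKets (X : Multiset (Fin k → Bool)) (j : ℕ) :
    (Gate.H (k + 1 + k + j)).apply (uniform (randKets X (bitStrings j))) =
      uniform (randKets X (bitStrings (j + 1))) := by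
  have hw : ∀ (x : Fin k → Bool) (z : List Bool), z.length = j →
      (List.ofFn x).length + 1 + (List.ofFn (fun _ : Fin k => false) ++ z).length =
        k + 1 + k + j := by
    intro x z hz; simp [hz, add_assoc]
  rw [Gate.H_uniform_clean]
  · congr 1
    rw [bitStrings_succ, randKets, randKets, Multiset.product_add, Multiset.map_add]
    have hp : ∀ f : List Bool → List Bool, X ×ˢ (bitStrings j).map f =
        (X ×ˢ bitStrings j).map fun xz => (xz.1, f xz.2) := by
      intro f
      simp only [SProd.sprod, Multiset.product, Multiset.map_bind, Multiset.map_map]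
      rfl
    rw [hp, hp, Multiset.map_map, Multiset.map_map, Multiset.map_map]
    congr 1
    · refine Multiset.map_congr rfl fun xz _ => ?_
      rw [Function.comp_apply, ← List.append_assoc, ket_append_false]
    · refine Multiset.map_congr rfl fun xz h => ?_
      have hz := mem_bitStrings.1 (Multiset.mem_product.1 h).2
      rw [Function.comp_apply, Function.comp_apply, ← List.append_assoc, ← hw xz.1 xz.2 hz,
        insert_ket_wire]
  · intro s hs
    obtain ⟨⟨x, z⟩, h, rfl⟩ := Multiset.mem_map.1 hs
    have hz := mem_bitStrings.1 (Multiset.mem_product.1 h).2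
    rw [← hw x z hz, mem_ket_wire]
    simp

/-- The data after one more pair of circuits, as a multiset. -/
def InvPair.extend (p : InvPair k) (X : Multiset (Fin k → Bool)) : Multiset (Fin k → Bool) :=
  X.bind fun x => (Finset.univ : Finset (Fin p.r → Bool)).val.map fun z => p.fwd.eval x z

lemma InvPair.extend_ne_zero (p : InvPair k) {X : Multiset (Fin k → Bool)} (hX : X ≠ 0) :
    p.extend X ≠ 0 := by
  obtain ⟨x, hx⟩ := Multiset.exists_mem_of_ne_zero hX
  have : p.fwd.eval x (fun _ => false) ∈ p.extend X :=
    Multiset.mem_bind.2 ⟨x, hx, Multiset.mem_map.2 ⟨_, Finset.mem_univ _, rfl⟩⟩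
  intro h
  rw [h] at this
  exact Multiset.notMem_zero _ this

/-- The circuit of the pair moves the data along, and erasing the random bits then leaves the data
alone. -/
lemma InvPair.map_circuit_randKets (p : InvPair k) (X : Multiset (Fin k → Bool)) :
    ((randKets X (bitStrings p.r)).map p.circuit.move).map
      (fun s => s \ Finset.Ico (k + 1 + k) (k + 1 + k + p.r)) = (p.extend X).map dataKet := by
  have hX : randKets X (bitStrings p.r) = X.bind fun x =>
      (Finset.univ : Finset (Fin p.r → Bool)).val.map fun z =>
        ket (List.ofFn x) (List.ofFn (fun _ : Fin k => false) ++ List.ofFn z) := by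
    simp only [randKets, bitStrings, SProd.sprod, Multiset.product, Multiset.map_bind,
      Multiset.map_map]
    rfl
  rw [hX, extend, Multiset.map_bind, Multiset.map_bind, Multiset.map_bind]
  refine Multiset.bind_congr fun x _ => ?_
  rw [Multiset.map_map, Multiset.map_map, Multiset.map_map]
  refine Multiset.map_congr rfl fun z _ => ?_
  simp only [Function.comp_apply, p.move_circuit]
  ext a
  rw [Finset.mem_sdiff, mem_ket, Finset.mem_Ico, dataKet, mem_ket, layout, layout,
    List.length_ofFn]
  split_ifs with h1 h2
  · simp only [and_iff_left_iff_imp]; omega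
  · simp
  · rw [List.ofFn_const, List.getD_eq_default [] _ (by simp)]
    rcases lt_or_ge a (k + 1 + k) with h | h
    · rw [List.getD_append _ _ _ _ (by simp; omega), List.getD_replicate (h := by omega)]
      simp
    · rcases lt_or_ge a (k + 1 + k + p.r) with h' | h'
      · simp [h, h']
      · rw [List.getD_eq_default _ _ (by simp; omega)]
        simp

lemma InvPair.notMem_of_mem_map_circuit (p : InvPair k) {X : Multiset (Fin k → Bool)} {s : Ket}
    (hs : s ∈ (randKets X (bitStrings p.r)).map p.circuit.move) : k ∉ s := by
  obtain ⟨u, hu, rfl⟩ := Multiset.mem_map.1 hs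
  obtain ⟨⟨x, z⟩, h, rfl⟩ := Multiset.mem_map.1 hu
  obtain ⟨z, -, rfl⟩ := Multiset.mem_map.1 (Multiset.mem_product.1 h).2
  dsimp only
  rw [p.move_circuit]
  have := length_notMem_ket (d := List.ofFn (p.fwd.eval x z))
    (w := List.ofFn (fun _ : Fin k => false) ++ List.ofFn z)
  rwa [List.length_ofFn] at this

lemma randKets_ne_zero {X : Multiset (Fin k → Bool)} (hX : X ≠ 0) (r : ℕ) :
    randKets X (bitStrings r) ≠ 0 := by
  obtain ⟨x, hx⟩ := Multiset.exists_mem_of_ne_zero hX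
  intro h
  have : _ ∈ randKets X (bitStrings r) := Multiset.mem_map.2 ⟨(x, List.replicate r false),
    Multiset.mem_product.2 ⟨hx, mem_bitStrings.2 (by simp)⟩, rfl⟩
  rw [h] at this
  exact Multiset.notMem_zero _ this

/-- The sum of the failure probabilities of the calls after the first `t` ones is at most this. -/
def failBound (δ t : ℕ) : ℝ := 1 / (δ * (t + 1))

variable {input : List ℕ} {d l p r inc lam δ t N : ℕ}

/-- Put `c` qubits from `q` on into the uniform superposition. -/
def hadamardLoop : Cmd := .loop 12 (.block [.gate (.H 13), .add 13 13 2, .sub 12 12 2])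

lemma runs_hadamardLoop (X : Multiset (Fin k → Bool)) :
    Runs input hadamardLoop
      (st { d := d, k := k, l := l, p := p, r := r, inc := inc, lam := lam, c := r,
            q := k + 1 + k } (uniform (X.map dataKet)))
      (st { d := d, k := k, l := l, p := p, r := r, inc := inc, lam := lam, c := 0,
            q := k + 1 + k + r } (uniform (randKets X (bitStrings r)))) (r * 5 + 1) 0 := by
  have h := Runs.for_loop (input := input) (a := 12)
    (s := .block [.gate (.H 13), .add 13 13 2, .sub 12 12 2]) r 3
    (fun j => st { d := d, k := k, l := l, p := p, r := r, inc := inc, lam := lam,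
                   c := r - j, q := k + 1 + k + j } (uniform (randKets X (bitStrings j))))
    (fun _ => 0) (fun j hj => by simp [st]) (fun j hj => rfl) (fun j hj => by
      refine Runs.block (by simp [Instr.Simple]) ?_
      rw [← H_uniform_randKets]
      simp [Instr.effect, st, Gate.map, Nat.sub_sub, add_assoc])
  simp only [randKets_zero, Nat.sub_zero, Nat.sub_self, add_zero, Finset.sum_const_zero] at h
  exact h

/-- Erase `c` random qubits from `q` on. The value of `λ` in the `t`-th call is `2 δ t (t + 1)`. -/
def eraseLoop : Cmd :=
  .loop 12 (.seq (.block [.newCircuit, .queryGate (.X 4), .newCircuit, .queryGate (.CNOT 4 13),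
    .queryQubit 4, .queryQubit 13, .add 8 8 3, .add 9 9 8])
  (.seq (.call 9) (.block [.gate (.X 4), .gate (.H 13), .add 13 13 2, .sub 12 12 2])))

lemma runs_eraseLoop {L : Multiset Ket} (hL : L ≠ 0) (hk : ∀ s ∈ L, k ∉ s) (hδ : 1 ≤ δ)
    (hN : t + r ≤ N) :
    Runs input eraseLoop
      (st { d := 4 * δ, k := k, l := l, p := p, r := r, inc := 4 * δ * t,
            lam := 2 * δ * t * (t + 1), c := r, q := k + 1 + k } (uniform L))
      (st { d := 4 * δ, k := k, l := l, p := p, r := r, inc := 4 * δ * (t + r),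
            lam := 2 * δ * (t + r) * (t + r + 1), c := 0, q := k + 1 + k + r }
        (uniform (L.map fun s => s \ Finset.Ico (k + 1 + k) (k + 1 + k + r))))
      (r * (18 + 2 * δ * N * (N + 1)) + 1) (failBound δ t - failBound δ (t + r)) := by
  have h := Runs.for_loop (input := input) (a := 12)
    (s := .seq (.block [.newCircuit, .queryGate (.X 4), .newCircuit, .queryGate (.CNOT 4 13),
        .queryQubit 4, .queryQubit 13, .add 8 8 3, .add 9 9 8])
      (.seq (.call 9) (.block [.gate (.X 4), .gate (.H 13), .add 13 13 2, .sub 12 12 2])))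
    r (16 + 2 * δ * N * (N + 1))
    (fun j => st { d := 4 * δ, k := k, l := l, p := p, r := r, inc := 4 * δ * (t + j),
                   lam := 2 * δ * (t + j) * (t + j + 1), c := r - j, q := k + 1 + k + j }
      (uniform (L.map fun s => s \ Finset.Ico (k + 1 + k) (k + 1 + k + j))))
    (fun j => failBound δ (t + j) - failBound δ (t + (j + 1)))
    (fun j hj => by simp [st]) (fun j hj => rfl) (fun j hj => by
      set L' := L.map fun s => s \ Finset.Ico (k + 1 + k) (k + 1 + k + j) with hL'
      have hL0 : L' ≠ 0 := by simpa [hL'] using hL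
      have hk' : ∀ s ∈ L', k ∉ s := by
        intro s hs
        obtain ⟨u, hu, rfl⟩ := Multiset.mem_map.1 hs
        exact fun h => hk u hu (Finset.mem_sdiff.1 h).1
      have hkq : k ≠ k + 1 + k + j := by omega
      set v : Vars := { d := 4 * δ, k := k, l := l, p := p, r := r, inc := 4 * δ * (t + (j + 1)),
                        lam := 2 * δ * (t + (j + 1)) * (t + (j + 1) + 1), c := r - j,
                        q := k + 1 + k + j } with hv
      have h1 : Runs input (.block [.newCircuit, .queryGate (.X 4), .newCircuit,
            .queryGate (.CNOT 4 13), .queryQubit 4, .queryQubit 13, .add 8 8 3, .add 9 9 8])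
          (st { d := 4 * δ, k := k, l := l, p := p, r := r, inc := 4 * δ * (t + j),
                lam := 2 * δ * (t + j) * (t + j + 1), c := r - j, q := k + 1 + k + j }
            (uniform L'))
          ⟨v.toMem, (eraseQuery k (k + 1 + k + j) v.lam).circuits,
            (eraseQuery k (k + 1 + k + j) v.lam).reg, uniform L'⟩ 8 0 := by
        refine Runs.block (by simp [Instr.Simple]) ?_
        simp only [Instr.effect, st, List.foldl_cons, List.foldl_nil, Vars.toMem_inc,
          Vars.toMem_d, Vars.toMem_lam, Vars.toMem_k, Vars.toMem_q, Vars.update_inc,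
          Vars.update_lam, appendGate, Gate.map, List.nil_append, hv, eraseQuery]
        congr 3
        ring
      -- the bound `2 / λ` is the difference of consecutive values of `failBound`
      have h2 := Runs.call (input := input) (a := 9)
        (S := ⟨v.toMem, (eraseQuery k (k + 1 + k + j) v.lam).circuits,
            (eraseQuery k (k + 1 + k + j) v.lam).reg, uniform L'⟩)
        (failBound δ (t + j) - failBound δ (t + (j + 1)))
        ((one_sub_successProb_eraseQuery_le (a := k) (b := k + 1 + k + j) (lam := v.lam) hkq
          (by positivity) hL0).trans (le_of_eq (by
            have hδ' : (0 : ℝ) < δ := by exact_mod_cast hδ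
            simp only [failBound, hv]
            push_cast
            field_simp
            ring)))
      have h3 : Runs input (.block [.gate (.X 4), .gate (.H 13), .add 13 13 2, .sub 12 12 2])
          (st v (QVec.normalize ((eraseQuery k (k + 1 + k + j) v.lam).OI (uniform L'))))
          (st { v with c := r - (j + 1), q := k + 1 + k + (j + 1) }
            (uniform (L.map fun s => s \ Finset.Ico (k + 1 + k) (k + 1 + k + (j + 1))))) 4 0 := by
        refine Runs.block (by simp [Instr.Simple]) ?_
        have hs : (L.map fun s => s \ Finset.Ico (k + 1 + k) (k + 1 + k + (j + 1))) =
            L'.map fun s => s.erase (k + 1 + k + j) := by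
          rw [hL', Multiset.map_map]
          refine Multiset.map_congr rfl fun s _ => ?_
          ext a
          simp only [Finset.mem_sdiff, Finset.mem_Ico, Function.comp_apply, Finset.mem_erase]
          constructor
          · rintro ⟨h, h'⟩; exact ⟨by omega, h, by omega⟩
          · rintro ⟨h, h', h2⟩; exact ⟨h', by omega⟩
        rw [hs, ← H_X_normalize_OI_eraseQuery (lam := v.lam) hkq hk']
        simp [Instr.effect, st, Gate.map, hv, Nat.sub_sub, add_assoc]
      simp only [Vars.update_result] at h2
      refine (h1.seq (h2.seq h3)).mono ?_ (by simp)
      have : v.lam ≤ 2 * δ * N * (N + 1) := by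
        simp only [hv]
        gcongr <;> omega
      simp only [OIQuery.cost, eraseQuery, List.map_cons, List.map_nil, List.sum_cons,
        List.sum_nil, List.length_cons, List.length_nil, Vars.toMem_lam]
      omega)
  have hsum := Finset.sum_range_sub' (fun j => failBound δ (t + j)) r
  simp only [add_zero] at hsum
  simp only [hsum, Nat.sub_zero, Nat.sub_self, add_zero, Finset.Ico_self, Finset.sdiff_empty,
    Multiset.map_id'] at h
  exact h.mono (by ring_nf; omega) rfl

/-- Choose the random bits in superposition and apply the circuit of one pair. -/
def evaluateCmd : Cmd :=
  .seq hadamardLoop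
  (.seq swapCmd (.seq circuitCmd (.seq swapCmd (.seq circuitCmd swapCmd))))

/-- Process one pair of circuits. -/
def pairCmd : Cmd :=
  .seq (.block [.sub 5 5 2, .read 7 6, .add 6 6 2, .add 13 18 4, .add 12 7 1])
  (.seq evaluateCmd
  (.seq (.block [.add 13 18 4, .add 12 7 1])
  (.seq eraseLoop
  (.block [.const 13 0, .const 7 0]))))

/-- The data between two pairs: `l` pairs are left, their description begins at position `p`, there
were `t` oracle calls, and the data register is in the uniform superposition of `X`. -/
def pairSt (δ l p t : ℕ) (X : Multiset (Fin k → Bool)) : St :=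
  st { d := 4 * δ, k := k, l := l, p := p, inc := 4 * δ * t, lam := 2 * δ * t * (t + 1) }
    (uniform (X.map dataKet))

lemma runs_pairCmd (pr : InvPair k) {X : Multiset (Fin k → Bool)} (hX : X ≠ 0) (hδ : 1 ≤ δ)
    (hN : t + pr.r ≤ N) (hg : SitsAt input p pr.encode) :
    Runs input pairCmd (pairSt δ (l + 1) p t X)
      (pairSt δ l (p + pr.encode.length) (t + pr.r) (pr.extend X))
      (100 * pr.encode.length + pr.r * (23 + 2 * δ * N * (N + 1)))
      (failBound δ t - failBound δ (t + pr.r)) := by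
  have hl : pr.encode.length = pr.fwd.encode.length + pr.bwd.encode.length + 1 := by
    rw [InvPair.encode, List.length_cons, List.length_append]
  rw [InvPair.encode] at hg
  have g0 := hg.getD_head 0
  have g1 := hg.tail.left
  have g2 := hg.tail.right
  have h1 : Runs input (.block [.sub 5 5 2, .read 7 6, .add 6 6 2, .add 13 18 4, .add 12 7 1])
      (pairSt δ (l + 1) p t X)
      (st { d := 4 * δ, k := k, l := l, p := p + 1, r := pr.r, inc := 4 * δ * t,
            lam := 2 * δ * t * (t + 1), c := pr.r, q := k + 1 + k }
        (uniform (X.map dataKet))) 5 0 := by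
    refine Runs.block (by simp [Instr.Simple]) ?_
    simp [Instr.effect, st, pairSt, g0, -List.getD_eq_getElem?_getD]
  have h2 := runs_hadamardLoop (input := input) (d := 4 * δ) (l := l) (p := p + 1) (r := pr.r)
    (inc := 4 * δ * t) (lam := 2 * δ * t * (t + 1)) X
  have h3 := h2.seq (runs_swapCmd.seq ((runs_circuitCmd pr.fwd g1).seq (runs_swapCmd.seq
    ((runs_circuitCmd pr.bwd g2).seq runs_swapCmd))))
  have hc : ∀ φ, (swapCircuit k k).apply (pr.bwd.xorCircuit.apply ((swapCircuit k k).apply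
      (pr.fwd.xorCircuit.apply ((swapCircuit k k).apply φ)))) = pr.circuit.apply φ := fun φ => by
    simp only [InvPair.circuit, QCircuit.apply_append]
  rw [hc, pr.circuit_classical.apply_uniform] at h3
  set L := (randKets X (bitStrings pr.r)).map pr.circuit.move with hL
  set p' := p + 1 + pr.fwd.encode.length + pr.bwd.encode.length with hp'
  have h4 : Runs input (.block [.add 13 18 4, .add 12 7 1])
      (st { d := 4 * δ, k := k, l := l, p := p', r := pr.r, inc := 4 * δ * t,
            lam := 2 * δ * t * (t + 1) } (uniform L))
      (st { d := 4 * δ, k := k, l := l, p := p', r := pr.r, inc := 4 * δ * t,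
            lam := 2 * δ * t * (t + 1), c := pr.r, q := k + 1 + k } (uniform L)) 2 0 := by
    refine Runs.block (by simp [Instr.Simple]) ?_
    simp [Instr.effect, st]
  have h5 := runs_eraseLoop (input := input) (l := l) (p := p') (r := pr.r) (δ := δ) (t := t)
    (L := L) (by simpa [hL] using randKets_ne_zero hX pr.r)
    (fun s hs => pr.notMem_of_mem_map_circuit hs) hδ hN
  rw [hL, pr.map_circuit_randKets, ← hL] at h5
  have h6 : Runs input (.block [.const 13 0, .const 7 0])
      (st { d := 4 * δ, k := k, l := l, p := p', r := pr.r, inc := 4 * δ * (t + pr.r),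
            lam := 2 * δ * (t + pr.r) * (t + pr.r + 1), c := 0, q := k + 1 + k + pr.r }
        (uniform ((pr.extend X).map dataKet)))
      (pairSt δ l (p + pr.encode.length) (t + pr.r) (pr.extend X)) 2 0 := by
    refine Runs.block (by simp [Instr.Simple]) ?_
    simp only [Instr.effect, st, pairSt, List.foldl_cons, List.foldl_nil, Vars.update_q,
      Vars.update_r]
    congr 3
    omega
  have hf := pr.fwd.length_encode
  have hb := pr.bwd.length_encode
  have h3' : Runs input evaluateCmd _ _ _ _ := h3
  refine (h1.seq (h3'.seq (h4.seq (h5.seq h6)))).mono ?_ (by simp)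
  have : pr.r * (23 + 2 * δ * N * (N + 1)) =
    pr.r * 5 + pr.r * (18 + 2 * δ * N * (N + 1)) := by ring
  rw [this, hl]
  omega

end Pair

/-! ### The whole program -/

/-- Process all pairs of circuits, after reading `δ`, `k` and the length of the sequence. -/
def mainCmd : Cmd :=
  .seq (.block [.const 0 1, .const 2 1, .read 3 1, .add 3 3 3, .add 3 3 3, .read 4 2, .add 6 2 2,
    .read 5 6, .add 6 6 2, .add 18 4 2, .const 19 3])
  (.loop 5 pairCmd)

lemma runs_init {input rest : List ℕ} {δ k l : ℕ} (h : input = δ :: k :: l :: rest) :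
    Runs input (.block [.const 0 1, .const 2 1, .read 3 1, .add 3 3 3, .add 3 3 3, .read 4 2,
        .add 6 2 2, .read 5 6, .add 6 6 2, .add 18 4 2, .const 19 3])
      ⟨fun _ => 0, [], ∅, Finsupp.single ∅ 1⟩
      (pairSt δ l 3 0 ({fun _ => false} : Multiset (Fin k → Bool))) 11 0 := by
  have hm : (fun _ => 0 : ℕ → ℕ) = memOf (List.replicate 20 0) := by
    funext n
    rw [memOf, List.getD_eq_getElem?_getD, List.getElem?_replicate]
    split_ifs <;> rfl
  have hk : dataKet (fun _ : Fin k => false) = ∅ := by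
    ext a
    rw [dataKet, List.ofFn_const, mem_ket, layout]
    simp only [List.length_replicate, Finset.notMem_empty, iff_false]
    split_ifs with h1
    · rw [List.getD_replicate (h := h1)]; decide
    · decide
    · simp
  have hu : uniform {(∅ : Ket)} = Finsupp.single ∅ 1 := by
    simp [uniform, ketSum, QVec.normalize, QVec.norm, QVec.normSq]
  refine Runs.block (by simp [Instr.Simple]) ?_
  rw [hm, h]
  simp only [Instr.effect, List.foldl_cons, List.foldl_nil, pairSt, st, Multiset.map_singleton, hk,
    hu, Vars.toMem]
  congr 1
  simp [update_memOf, memOf, List.replicate]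
  rw [show δ + δ + (δ + δ) = 4 * δ by ring]

lemma runs_pairs {k δ N : ℕ} {input : List ℕ} (hδ : 1 ≤ δ) (ps : List (InvPair k)) (p t : ℕ)
    {X : Multiset (Fin k → Bool)} (hX : X ≠ 0) (hN : t + (ps.map InvPair.r).sum ≤ N)
    (hg : SitsAt input p (ps.flatMap InvPair.encode)) :
    ∃ p', Runs input (.loop 5 pairCmd) (pairSt δ ps.length p t X)
      (pairSt δ 0 p' (t + (ps.map InvPair.r).sum) (ps.foldl (fun X pr => pr.extend X) X))
      (102 * (ps.flatMap InvPair.encode).length +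
        (ps.map InvPair.r).sum * (23 + 2 * δ * N * (N + 1)) + 1)
      (failBound δ t - failBound δ (t + (ps.map InvPair.r).sum)) := by
  induction ps generalizing p t X with
  | nil => exact ⟨p, (Runs.while_zero rfl).mono (by simp) (by simp)⟩
  | cons pr ps ih =>
    rw [List.flatMap_cons] at hg
    rw [List.map_cons, List.sum_cons] at hN
    have h1 := runs_pairCmd (l := ps.length) (p := p) (t := t) (N := N) pr hX hδ (by omega) hg.left
    obtain ⟨p', h2⟩ := ih (p + pr.encode.length) (t + pr.r) (pr.extend_ne_zero hX)
      (by omega) hg.right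
    have h3 := Runs.while_succ (a := 5) (by simp [pairSt, st]) rfl h1 h2
    refine ⟨p', ?_⟩
    rw [List.map_cons, List.sum_cons, List.foldl_cons, List.flatMap_cons, List.length_append,
      ← add_assoc, List.length_cons]
    have : 1 ≤ pr.encode.length := by simp [InvPair.encode]
    exact h3.mono (by ring_nf; omega) (by ring)

/-- The program: it reads `δ` and a sequence of circuits. -/
def mainProgram : Program := mainCmd.compile 0

lemma length_mainProgram : mainProgram.length ≤ exitPos := by
  rw [mainProgram, Cmd.length_compile]
  decide

/-! ### The output -/

/-- Choosing all random strings at once amounts to choosing them one after the other. -/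
lemma bind_map_foldl {α : Type*} (n : ℕ) (A : Fin n → Type) [∀ i, Fintype (A i)]
    (f : ∀ i, α → A i → α) (X : Multiset α) :
    (X.bind fun x => (Finset.univ : Finset (∀ i, A i)).val.map fun z =>
      Fin.foldl n (fun x i => f i x (z i)) x) =
    Fin.foldl n (fun X i => X.bind fun x => (Finset.univ : Finset (A i)).val.map (f i x)) X := by
  induction n generalizing X with
  | zero =>
    have := Multiset.bind_singleton X id
    simpa using this
  | succ n ih =>
    rw [Fin.foldl_succ, ← ih (fun i => A i.succ) (fun i => f i.succ), Multiset.bind_assoc]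
    refine Multiset.bind_congr fun x _ => ?_
    rw [Multiset.bind_map, ← Multiset.map_univ_val_equiv (Fin.consEquiv A), Multiset.map_map,
      ← Finset.univ_product_univ, Finset.product_val]
    simp only [SProd.sprod, Multiset.product, Multiset.map_bind, Multiset.map_map,
      Function.comp_apply, Fin.foldl_succ]
    rfl

lemma foldl_extend (C : InvCircuitSeq) :
    (List.ofFn C.pair).foldl (fun X p => p.extend X) {fun _ => false} =
      (Finset.univ : Finset ((i : Fin C.ℓ) → Fin (C.pair i).r → Bool)).val.map C.sample := by
  have := bind_map_foldl C.ℓ (fun i => Fin (C.pair i).r → Bool)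
    (fun i x z => (C.pair i).fwd.eval x z) {fun _ => false}
  rw [Multiset.singleton_bind] at this
  rw [List.ofFn_eq_map, List.foldl_map, ← Fin.foldl_eq_foldl_finRange]
  exact this.symm

section Output

variable {k : ℕ}

lemma mem_dataKet {x : Fin k → Bool} {a : ℕ} : a ∈ dataKet x ↔ ∃ h : a < k, x ⟨a, h⟩ = true := by
  rw [dataKet, mem_ket, layout, List.length_ofFn]
  split_ifs with h1 h2
  · simp [h1]
  · simp [h1]
  · simp [h1]

lemma dataKet_eq_iff {x : Fin k → Bool} {s : Ket} :
    s = dataKet x ↔ (fun i : Fin k => decide ((i : ℕ) ∈ s)) = x ∧ s \ Finset.range k = ∅ := by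
  constructor
  · rintro rfl
    refine ⟨?_, ?_⟩
    · funext i; simp [mem_dataKet]
    · ext a
      simp only [Finset.mem_sdiff, mem_dataKet, Finset.mem_range, Finset.notMem_empty, iff_false]
      rintro ⟨⟨h, -⟩, h'⟩
      exact h' h
  · rintro ⟨rfl, h⟩
    ext a
    rw [mem_dataKet]
    constructor
    · intro ha
      have : a < k := Finset.mem_range.1 (Finset.sdiff_eq_empty_iff_subset.1 h ha)
      exact ⟨this, by simpa using ha⟩
    · rintro ⟨_, ha⟩
      simpa using ha

lemma dataKet_injective : Function.Injective (dataKet (k := k)) := by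
  intro x y h
  rw [← (dataKet_eq_iff.1 (rfl : dataKet x = dataKet x)).1, h]
  exact (dataKet_eq_iff.1 rfl).1

lemma ketSum_dataKet_apply (C : InvCircuitSeq) (s : Ket) :
    ketSum ((Finset.univ.val.map C.sample).map dataKet) s =
      C.outVec (fun i => decide ((i : ℕ) ∈ s)) *
        (Finsupp.single ∅ 1 : QVec) (s \ Finset.range C.k) := by
  rw [ketSum, Multiset.map_map, Multiset.map_map, InvCircuitSeq.outVec]
  change (∑ z, Finsupp.single (dataKet (C.sample z)) (1 : ℂ)) s = _
  rw [Finsupp.finsetSum_apply, WithLp.ofLp_sum, Finset.sum_apply, Finset.sum_mul]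
  refine Finset.sum_congr rfl fun z _ => ?_
  rw [Finsupp.single_apply, Finsupp.single_apply]
  by_cases h : s = dataKet (C.sample z)
  · obtain ⟨h1, h2⟩ := dataKet_eq_iff.1 h
    rw [if_pos h.symm, h1, h2]
    simp
  · rw [if_neg (Ne.symm h)]
    by_cases h2 : s \ Finset.range C.k = ∅
    · have h1 : (fun i : Fin C.k => decide ((i : ℕ) ∈ s)) ≠ C.sample z := fun h1 =>
        h (dataKet_eq_iff.2 ⟨h1, h2⟩)
      simp [h1]
    · rw [if_neg (Ne.symm h2), mul_zero]

lemma norm_ketSum_dataKet (C : InvCircuitSeq) :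
    QVec.norm (ketSum ((Finset.univ.val.map C.sample).map dataKet)) = ‖C.outVec‖ := by
  rw [QVec.norm, EuclideanSpace.norm_eq]
  congr 1
  rw [QVec.normSq_eq_sum (A := Finset.univ.image (dataKet (k := C.k))),
    Finset.sum_image fun x _ y _ h => dataKet_injective h]
  · refine Finset.sum_congr rfl fun x _ => ?_
    obtain ⟨h1, h2⟩ := dataKet_eq_iff.1 (rfl : dataKet x = dataKet x)
    rw [ketSum_dataKet_apply, h1, h2]
    simp
  · intro s hs
    rw [Finsupp.mem_support_iff, ketSum_dataKet_apply] at hs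
    have : s \ Finset.range C.k = ∅ := by
      by_contra h
      rw [Finsupp.single_apply, if_neg (Ne.symm h), mul_zero] at hs
      exact hs rfl
    exact Finset.mem_image.2 ⟨_, Finset.mem_univ _, (dataKet_eq_iff.2 ⟨rfl, this⟩).symm⟩

lemma outputIs_uniform (C : InvCircuitSeq) (c : Config)
    (hc : c.state = uniform ((Finset.univ.val.map C.sample).map dataKet)) :
    c.OutputIs C.outState := by
  refine ⟨Finsupp.single ∅ 1, by simp [QVec.norm, QVec.normSq], ?_, fun s => ?_⟩
  · intro s hs
    have : s = ∅ := by
      by_contra h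
      exact Finsupp.mem_support_iff.1 hs (Finsupp.single_eq_of_ne h)
    simp [this]
  · rw [hc, uniform_eq, Finsupp.smul_apply, ketSum_dataKet_apply, norm_ketSum_dataKet,
      InvCircuitSeq.outState, smul_eq_mul, ← mul_assoc]
    rfl

end Output

/-! ### The time -/

lemma succ_cube_le (r : ℕ) : (r + 1) ^ 3 ≤ 8 * 2 ^ r := by
  obtain h | h := Nat.lt_or_ge r 4
  · interval_cases r <;> norm_num
  · induction r, h using Nat.le_induction with
    | base => norm_num
    | succ r hr ih =>
      rw [pow_succ 2 r]
      have : (r + 1 + 1) ^ 3 ≤ 2 * (r + 1) ^ 3 := by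
        obtain ⟨m, rfl⟩ := Nat.exists_eq_add_of_le hr
        nlinarith [Nat.zero_le m, Nat.zero_le (m ^ 2), Nat.zero_le (m ^ 3)]
      omega

lemma time_bound {n δ r L N : ℕ} (hδ : 1 ≤ δ) (hL : L ≤ n) (hn : 1 ≤ n) (hN : N ≤ L * r) :
    11 + (102 * L + N * (23 + 2 * δ * N * (N + 1)) + 1) + 1 ≤
      δ * (13 + 102 * n + 216 * n ^ 3) * 2 ^ r := by
  set M := n * (r + 1) with hM
  have hM1 : 1 ≤ M := Nat.mul_pos hn (Nat.succ_pos r)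
  have hNM : N ≤ M := hN.trans (Nat.mul_le_mul hL (Nat.le_succ r))
  have h2 : 1 ≤ 2 ^ r := Nat.one_le_two_pow
  have h3 : N * (23 + 2 * δ * N * (N + 1)) ≤ 27 * (δ * M ^ 3) := by
    calc N * (23 + 2 * δ * N * (N + 1)) ≤ M * (23 * δ * M * M + 2 * δ * M * (M + M)) := by
          gcongr
          nlinarith [Nat.mul_le_mul hδ (Nat.mul_le_mul hM1 hM1)]
      _ = 27 * (δ * M ^ 3) := by ring
  have h4 : M ^ 3 ≤ n ^ 3 * (8 * 2 ^ r) := by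
    rw [hM, mul_pow]
    exact Nat.mul_le_mul_left _ (succ_cube_le r)
  calc 11 + (102 * L + N * (23 + 2 * δ * N * (N + 1)) + 1) + 1
      ≤ (13 + 102 * n) * 1 + 27 * (δ * M ^ 3) := by omega
    _ ≤ (13 + 102 * n) * (δ * 2 ^ r) + 27 * (δ * (n ^ 3 * (8 * 2 ^ r))) := by
        gcongr
        exact Nat.mul_pos hδ h2
    _ = δ * (13 + 102 * n + 216 * n ^ 3) * 2 ^ r := by ring

lemma length_le_sum_size (L : List ℕ) : L.length ≤ (L.map fun a => a.size + 1).sum := by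
  induction L with
  | nil => simp
  | cons a L ih => simp only [List.length_cons, List.map_cons, List.sum_cons]; omega

end
end OIModel

open OIModel in
theorem mainTheorem4 :
    ∃ (Q : OIModel.Program) (poly : Polynomial ℕ),
      ∀ (O : OIModel.OIOracle) (δ : ℕ) (C : OIModel.InvCircuitSeq) (r : ℕ),
        1 ≤ δ → C.IsInvertible r →
          let T : ℕ := δ * poly.eval C.descSize * 2 ^ r
          let input : List ℕ := δ :: C.encode
          Q.HaltsWithin O input T ∧
          (∀ c ∈ (Q.run O input T).support,
            (c.outBit = 0 ∨ c.outBit = 1) ∧ (c.outBit = 1 → c.OutputIs C.outState)) ∧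
          1 - 1 / (δ : ℝ) ≤
            ((Q.run O input T).toOuterMeasure {c | c.outBit = 1}).toReal := by
  refine ⟨mainProgram, 13 + 102 * Polynomial.X + 216 * Polynomial.X ^ 3, ?_⟩
  intro O δ C r hδ hr T input
  set ps := List.ofFn C.pair with hps
  set N := (ps.map InvPair.r).sum with hN
  set L := (ps.flatMap InvPair.encode).length with hL
  have hflat : (List.ofFn fun i => (C.pair i).encode).flatten = ps.flatMap InvPair.encode := by
    rw [hps, List.flatMap, List.map_ofFn]; rfl
  have hinput : input = δ :: C.k :: C.ℓ :: ps.flatMap InvPair.encode := by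
    rw [← hflat]; rfl
  have hsits : SitsAt input 3 (ps.flatMap InvPair.encode) := by
    rw [hinput]; exact List.prefix_rfl
  obtain ⟨p', hpairs⟩ := runs_pairs (N := N) hδ ps 3 0
    (X := {fun _ => false}) (Multiset.singleton_ne_zero _) (by omega) hsits
  have hlen : ps.length = C.ℓ := by simp [hps]
  rw [hlen, ← hN, ← hL] at hpairs
  obtain ⟨t', ht', hpath⟩ := ((runs_init hinput).seq hpairs) mainProgram 0
    (by rw [SitsAt, List.drop_zero]; exact List.prefix_rfl) 0
  rw [hps, foldl_extend] at hpath
  -- the bound on the time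
  have hLn : L + 2 ≤ C.descSize := by
    have := length_le_sum_size C.encode
    rw [InvCircuitSeq.encode, hflat] at this
    rw [InvCircuitSeq.descSize, InvCircuitSeq.encode, hflat]
    exact this
  have hNL : N ≤ L * r := by
    have h1 : N ≤ ps.length * r := by
      have := List.sum_le_card_nsmul (ps.map InvPair.r) r (by
        intro x hx
        obtain ⟨p, hp, rfl⟩ := List.mem_map.1 hx
        obtain ⟨i, rfl⟩ := (List.mem_ofFn' _ _).1 hp
        exact hr i)
      simpa using this
    refine h1.trans (Nat.mul_le_mul_right r ?_)
    rw [hL]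
    clear_value ps
    clear * -
    induction ps with
    | nil => simp
    | cons p ps ih =>
      rw [List.flatMap_cons, List.length_append, List.length_cons]
      have : 1 ≤ p.encode.length := by simp [InvPair.encode]
      omega
  have hT : 11 + (102 * L + N * (23 + 2 * δ * N * (N + 1)) + 1) + 1 ≤ T := by
    refine (time_bound hδ (by omega : L ≤ C.descSize) (by omega) hNL).trans (le_of_eq ?_)
    simp [T]
  set c' := (pairSt δ 0 p' (0 + N) ((Finset.univ.val.map C.sample))).config
    (0 + mainCmd.size) t' with hc'
  have hhalt : mainProgram.Halted c' := by
    rw [Program.Halted, mainProgram, Cmd.length_compile]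
    exact (zero_add _).ge
  obtain ⟨hsupp, hprob⟩ := hpath.evolve length_mainProgram hhalt O T
    (by change t' + 1 ≤ 0 + T; omega)
  have hrun : mainProgram.run O input T = mainProgram.evolve O input T initConfig :=
    Program.run_eq_evolve _ _ _ _
  have hcfg : (St.config ⟨fun _ => 0, [], ∅, Finsupp.single ∅ 1⟩ 0 0) = initConfig := rfl
  rw [hcfg, ← hrun] at hsupp hprob
  have hout : c'.outBit = 1 := rfl
  refine ⟨fun c hc => ?_, fun c hc => ?_, ?_⟩
  · rcases hsupp c hc with rfl | ⟨h1, -, h3⟩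
    · exact ⟨hhalt, show t' ≤ T by omega⟩
    · have h4 : c.time ≤ t' + 1 := h3
      exact ⟨h1, by omega⟩
  · rcases hsupp c hc with rfl | ⟨-, h2, -⟩
    · exact ⟨Or.inr hout, fun _ => outputIs_uniform C _ rfl⟩
    · exact ⟨Or.inl h2, fun h => absurd (h2.symm.trans h) (by decide)⟩
  · have h1 : (mainProgram.run O input T) c' ≤
        (mainProgram.run O input T).toOuterMeasure {c | c.outBit = 1} := by
      rw [← PMF.toOuterMeasure_apply_singleton]
      exact MeasureTheory.measure_mono (Set.singleton_subset_iff.2 hout)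
    have h2 : (mainProgram.run O input T).toOuterMeasure {c | c.outBit = 1} ≠ ⊤ := by
      rw [PMF.toOuterMeasure_apply]
      exact PMF.tsum_coe_indicator_ne_top _ _
    refine le_trans ?_ (hprob.trans (ENNReal.toReal_mono h2 h1))
    have h3 : 0 ≤ failBound δ (0 + N) := by unfold failBound; positivity
    have h4 : failBound δ 0 = 1 / δ := by simp [failBound]
    linarith
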